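/- Let $K$ be a field of characteristic zero and, for $n\ge 1$, let $P_n=K[x_1,\dots,x_n]$. Let $\mathbb I_n$ be the algebra of polynomial integro-differential operators, i.e. the subalgebra of $\operatorname{End}_K(P_n)$ generated by the multiplications by $x_1,\dots,x_n$, the partial derivatives $\partial_1,\dots,\partial_n$ and the integrations $\int_1,\dots,\int_n$, where $\int_i$ is the $K$-linear map $x^{s}\mapsto \frac{1}{s_i+1}\,x_i x^{s}$ on monomials; put $\mathbb I_0=K$. A ring $R$ is called left (resp. right) coherent if every finitely generated left (resp. right) ideal of $R$ is finitely presented. (1) For every $n\ge 1$, the algebra $\mathbb I_n$ is left coherent if and only if it is right coherent, if and only if $n=1$. (2) Let $n\ge 2$ and $H_i=\partial_i x_i\in\mathbb I_n$. There is a $K$-algebra isomorphism $\mathbb I_2\otimes_K\mathbb I_{n-2}\simeq \mathbb I_n$ that identifies $x_i\otimes 1,\ \partial_i\otimes 1,\ \int_i\otimes 1$ with $x_i,\partial_i,\int_i$ for $i=1,2$, and $1\otimes x_j,\ 1\otimes\partial_j,\ 1\otimes\int_j$ with $x_{j+2},\partial_{j+2},\int_{j+2}$ for $1\le j\le n-2$.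 Regard $P_2\otimes_K\mathbb I_{n-2}$ as a left $\mathbb I_n$-module through it, by $(a\otimes b)(p\otimes c)=a(p)\otimes bc$. Then the left ideal $\{a\in\mathbb I_n : a(H_1-H_2)=0\}$ is isomorphic, as a left $\mathbb I_n$-module, to the infinite direct sum $\bigoplus_{k\in\mathbb N}(P_2\otimes_K\mathbb I_{n-2})$; in particular it is not finitely generated. -/

import Mathlib

open scoped TensorProduct

noncomputable section

/-- A module is coherent if it is finitely generated and each of its finitely generated
submodules is finitely presented. -/
def IsCoherentModule (R M : Type*) [Ring R] [AddCommGroup M] [Module R M] : Prop :=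
  Module.Finite R M ∧ ∀ N : Submodule R M, N.FG → Module.FinitePresentation R N

/-- `R` is left coherent if the left module `R` over `R` is coherent. -/
def IsLeftCoherentRing (R : Type*) [Ring R] : Prop :=
  IsCoherentModule R R

/-- `R` is right coherent if the right module `R` over `R` is coherent; right modules are modules
over the opposite ring. -/
def IsRightCoherentRing (R : Type*) [Ring R] : Prop :=
  IsCoherentModule Rᵐᵒᵖ R

namespace IntegroDiff

variable (K : Type*) [Field K] {n : ℕ}

/-- Multiplication by `x_i` on `K[x_1, …, x_n]`. -/
def mulX (i : Fin n) : Module.End K (MvPolynomial (Fin n) K) :=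
  LinearMap.mulLeft K (MvPolynomial.X i)

/-- The partial derivative `∂_i` on `K[x_1, …, x_n]`. -/
def partialD (i : Fin n) : Module.End K (MvPolynomial (Fin n) K) :=
  (MvPolynomial.pderiv i).toLinearMap

/-- The integration `∫_i` on `K[x_1, …, x_n]`: the linear map that sends a monomial `x^s` to
`x_i x^s / (s_i + 1)`. -/
def integral (i : Fin n) : Module.End K (MvPolynomial (Fin n) K) :=
  (MvPolynomial.basisMonomials (Fin n) K).constr K fun s =>
    MvPolynomial.monomial (s + Finsupp.single i 1) ((s i + 1 : K)⁻¹)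

theorem integral_monomial (i : Fin n) (s : Fin n →₀ ℕ) (c : K) :
    integral K i (MvPolynomial.monomial s c)
      = MvPolynomial.monomial (s + Finsupp.single i 1) (c / (s i + 1 : K)) := by
  have h : (MvPolynomial.monomial s c : MvPolynomial (Fin n) K)
      = c • MvPolynomial.basisMonomials (Fin n) K s := by
    simp [MvPolynomial.smul_monomial]
  rw [h, map_smul, integral, Module.Basis.constr_basis, MvPolynomial.smul_monomial, smul_eq_mul,
    div_eq_mul_inv]

/-- In characteristic zero `∂_i ∫_i = 1`. -/
theorem partialD_mul_integral [CharZero K] (i : Fin n) : partialD K i * integral K i = 1 := by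
  refine (MvPolynomial.basisMonomials (Fin n) K).ext fun s => ?_
  have h : (s i + 1 : K) ≠ 0 := by exact_mod_cast Nat.succ_ne_zero (s i)
  simp [partialD, integral_monomial, MvPolynomial.pderiv_monomial, h]

variable (n) in
/-- The algebra `𝕀_n` of polynomial integro-differential operators: the subalgebra of
`End_K(K[x_1, …, x_n])` generated by all `x_i`, `∂_i` and `∫_i`. -/
def algebraI : Subalgebra K (Module.End K (MvPolynomial (Fin n) K)) :=
  Algebra.adjoin K
    (Set.range (mulX K (n := n)) ∪ Set.range (partialD K (n := n)) ∪
      Set.range (integral K (n := n)))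

/-- `x_i` as an element of `𝕀_n`. -/
def x (i : Fin n) : algebraI K n :=
  ⟨mulX K i, Algebra.subset_adjoin (Or.inl (Or.inl ⟨i, rfl⟩))⟩

/-- `∂_i` as an element of `𝕀_n`. -/
def d (i : Fin n) : algebraI K n :=
  ⟨partialD K i, Algebra.subset_adjoin (Or.inl (Or.inr ⟨i, rfl⟩))⟩

/-- `∫_i` as an element of `𝕀_n`. -/
def int (i : Fin n) : algebraI K n :=
  ⟨integral K i, Algebra.subset_adjoin (Or.inr ⟨i, rfl⟩)⟩

/-- `H_i = ∂_i x_i`. -/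
def H (i : Fin n) : algebraI K n := d K i * x K i

/-- `ker_R(· r) = {a ∈ R | a r = 0}`, a left ideal of `R`. -/
def kerMulRight {R : Type*} [Ring R] (r : R) : Submodule R R :=
  LinearMap.ker (LinearMap.toSpanSingleton R R r)

theorem mem_kerMulRight {R : Type*} [Ring R] (r a : R) : a ∈ kerMulRight r ↔ a * r = 0 :=
  Iff.rfl

/-- An algebra isomorphism `𝕀_k ⊗ 𝕀_m ≃ 𝕀_{k+m}` is the canonical one if it identifies the
operators in the first `k` variables with those of `𝕀_k`, and the operators in the last `m`
variables with those of `𝕀_m`. As the operators `x_i`, `∂_i`, `∫_i` generate, there is at most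
one such isomorphism. -/
def IsCanonicalIso {k m : ℕ}
    (e : (algebraI K k ⊗[K] algebraI K m) ≃ₐ[K] algebraI K (k + m)) : Prop :=
  (∀ i : Fin k,
    e (x K i ⊗ₜ 1) = x K (Fin.castAdd m i) ∧
    e (d K i ⊗ₜ 1) = d K (Fin.castAdd m i) ∧
    e (int K i ⊗ₜ 1) = int K (Fin.castAdd m i)) ∧
  (∀ j : Fin m,
    e (1 ⊗ₜ x K j) = x K (Fin.natAdd k j) ∧
    e (1 ⊗ₜ d K j) = d K (Fin.natAdd k j) ∧
    e (1 ⊗ₜ int K j) = int K (Fin.natAdd k j))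

end IntegroDiff

end

/-! Everything is read off in the basis of divided powers `x^s / s!`: there `∫_i` and `∂_i` shift
the index and `x_i` shifts it with the factor `s_i + 1`. For the symmetric form making this basis
orthonormal, `∫_i` and `∂_i` are mutually adjoint and the adjoint of `x_i` is `∂_i x_i ∂_i`. So the
adjoint is an isomorphism of `𝕀_n` with its opposite ring (`adjEquiv`), which makes left and right
coherence equivalent.

In one variable, an operator agrees on all large powers with a finite sum of shifts with polynomial
coefficients, its symbol. A zero symbol means finite rank; a nonzero one forces a finite-dimensional
kernel and a range of finite codimension. Hence the finite rank operators form a completely prime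
two-sided ideal `F`, and a Hilbert basis argument on symbols shows that `𝕀_1 / F` is left
Noetherian. Left ideals inside `F` are governed by spaces of row vectors, on which right
multiplication by `c` acts through the adjoint of `c`. For coherence it suffices that `(I : r) = {a
| a r ∈ I}` is finitely generated for `I` finitely generated. If it is not inside `F`, this is
`fg_of_not_le_finiteRank`. If it is, then `r ∉ F`, and the Ore condition in `𝕀_1 / F` forces `I ≤
F`; the row space of `(I : r)` is the preimage of a finite-dimensional space under a map with
finite-dimensional kernel.

For `n ≥ 2`, `a (H_1 - H_2) = 0` means that `a` kills every `x₁^i x₂^j` with `i ≠ j`. Coefficients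
of `a` are eventually polynomial in the first index, so this vanishing spreads to the diagonal: `a`
kills `x₁^k x₂^k` for all large `k` (`eventually_apply_diag_eq_zero`). Thus `a` is a finite sum of
operators, each supported at one diagonal monomial, which gives the direct sum. Finitely many
generators would all vanish at some common `x₁^k x₂^k`, so the ideal is not finitely generated, and
coherence fails. -/

noncomputable section

/-! ### Left ideals of a general ring. -/

/-- Left ideals of a ring. -/
abbrev LeftIdeal (R : Type*) [Ring R] := Submodule R R

theorem LeftIdeal.sub_mem {R : Type*} [Ring R] (L : LeftIdeal R) {a b : R} (ha : a ∈ L)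
    (hb : b ∈ L) : a - b ∈ L :=
  Submodule.sub_mem L ha hb

theorem LeftIdeal.mem_of_add_mem {R : Type*} [Ring R] (L : LeftIdeal R) {a b : R} (hab : a + b ∈ L)
    (ha : a ∈ L) : b ∈ L :=
  (L.add_mem_iff_right ha).1 hab

theorem LeftIdeal.mul_mem_of_mul_add_eq_zero {R : Type*} [Ring R] (L : LeftIdeal R) {p a b r s : R}
    (hr : r ∈ L) (h : p * (a * r + b * s) = 0) : p * b * s ∈ L := by
  have : p * b * s = -(p * a) * r := by
    rw [mul_add] at h
    rw [neg_mul, mul_assoc, mul_assoc]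
    exact eq_neg_of_add_eq_zero_right h
  rw [this]
  exact L.smul_mem _ hr

/-- The sum telescopes. With `u = ∫` and `v = ∂` it splits the identity into degrees below `m` and
the rest. -/
theorem one_eq_sum_pow_mul_add {R : Type*} [Ring R] (u v : R) (m : ℕ) :
    1 = ∑ i ∈ Finset.range m, u ^ i * ((1 - u * v) * v ^ i) + u ^ m * v ^ m := by
  induction m with
  | zero => simp
  | succ m ih =>
    rw [Finset.sum_range_succ, add_assoc]
    convert ih using 2
    rw [pow_succ u, pow_succ' v]
    noncomm_ring

theorem isNoetherian_quotient_of_fg_sup {R : Type*} [Ring R] {F : LeftIdeal R}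
    (h : ∀ L : LeftIdeal R, ∃ L' ≤ L, L'.FG ∧ L ≤ L' ⊔ F) : IsNoetherian R (R ⧸ F) := by
  refine ⟨fun N => ?_⟩
  obtain ⟨L', hle, hfg, hsup⟩ := h (N.comap F.mkQ)
  have : N = L'.map F.mkQ := by
    apply le_antisymm
    · rw [← Submodule.map_comap_eq_of_surjective F.mkQ_surjective N]
      refine (Submodule.map_mono hsup).trans ?_
      rw [Submodule.map_sup]
      exact sup_le le_rfl (by simp)
    · exact Submodule.map_le_iff_le_comap.2 hle
  rw [this]
  exact hfg.map _

/-- The Ore condition modulo a completely prime ideal with Noetherian quotient. -/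
theorem exists_mul_add_mul_mem {R : Type*} [Ring R] {F : LeftIdeal R} [IsNoetherian R (R ⧸ F)]
    (h1 : (1 : R) ∉ F) (hmul : ∀ a ∈ F, ∀ r, a * r ∈ F)
    (hdom : ∀ a r, a * r ∈ F → r ∉ F → a ∈ F) {r : R} (hr : r ∉ F) (s : R) :
    ∃ a b, b ∉ F ∧ a * r + b * s ∈ F := by
  -- Right multiplication by `y` descends to `R ⧸ F` because `F` is two-sided.
  let m : ∀ y : R, (R ⧸ F) →ₗ[R] (R ⧸ F) := fun y =>
    F.mapQ F (LinearMap.toSpanSingleton R R y) fun a ha => hmul a ha y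
  let f : (R ⧸ F) × (R ⧸ F) →ₗ[R] (R ⧸ F) := (m r).coprod (m s)
  -- A nonzero Noetherian module does not contain a copy of its own square, so `f` has a nonzero
  -- kernel element; it supplies `a` and `b`.
  have hf : ¬ Function.Injective f := fun hf => by
    have := IsNoetherian.subsingleton_of_prod_injective f hf
    exact h1 ((Submodule.Quotient.mk_eq_zero F).1 (Subsingleton.elim _ _))
  rw [injective_iff_map_eq_zero] at hf
  push Not at hf
  obtain ⟨⟨a, b⟩, h0, hne⟩ := hf
  obtain ⟨a, rfl⟩ := F.mkQ_surjective a
  obtain ⟨b, rfl⟩ := F.mkQ_surjective b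
  have hab : a * r + b * s ∈ F := (Submodule.Quotient.mk_eq_zero F).1 h0
  refine ⟨a, b, fun hb => hne ?_, hab⟩
  have ha : a ∈ F := by
    refine hdom a r ?_ hr
    have := F.sub_mem hab (hmul b hb s)
    rwa [add_sub_cancel_right] at this
  rw [Submodule.mkQ_apply, Submodule.mkQ_apply, (Submodule.Quotient.mk_eq_zero _).2 ha,
    (Submodule.Quotient.mk_eq_zero _).2 hb]
  rfl

/-- An additive bijection onto a left ideal. -/
def LeftIdeal.addEquivOfBijOn {A R : Type*} [Add A] [Ring R] (L : LeftIdeal R) (f : A → R)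
    (hadd : ∀ x y, f (x + y) = f x + f y) (hmem : ∀ x, f x ∈ L) (hinj : Function.Injective f)
    (hsurj : ∀ a ∈ L, ∃ x, f x = a) : A ≃+ L :=
  { Equiv.ofBijective (fun x => (⟨f x, hmem x⟩ : L))
      ⟨fun _ _ h => hinj (congrArg Subtype.val h),
        fun a => (hsurj a.1 a.2).imp fun _ h => Subtype.ext h⟩ with
    map_add' := fun x y => Subtype.ext (hadd x y) }

theorem LeftIdeal.coe_addEquivOfBijOn {A R : Type*} [Add A] [Ring R] (L : LeftIdeal R) (f : A → R)
    (hadd : ∀ x y, f (x + y) = f x + f y) (hmem : ∀ x, f x ∈ L) (hinj : Function.Injective f)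
    (hsurj : ∀ a ∈ L, ∃ x, f x = a) (x : A) :
    (L.addEquivOfBijOn f hadd hmem hinj hsurj x : R) = f x := rfl

/-! ### Criteria for coherence, and its transport to the opposite ring. -/

theorem kerMulRight_toSpan {R : Type*} [Ring R] (r : R) :
    IntegroDiff.kerMulRight r = LinearMap.ker (LinearMap.toSpanSingleton R R r).rangeRestrict := by
  rw [LinearMap.ker_rangeRestrict]; rfl

theorem IsLeftCoherentRing.fg_kerMulRight {R : Type*} [Ring R] (h : IsLeftCoherentRing R) (r : R) :
    (IntegroDiff.kerMulRight r).FG := by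
  have hfg : (LinearMap.range (LinearMap.toSpanSingleton R R r)).FG := by
    rw [LinearMap.range_toSpanSingleton]
    exact Submodule.fg_span_singleton r
  have := h.2 _ hfg
  rw [kerMulRight_toSpan]
  exact Module.FinitePresentation.fg_ker _ (LinearMap.surjective_rangeRestrict _)

/-- The map `R → (I + R r) / I`, `a ↦ a r`. -/
def toQuotSup {R : Type*} [Ring R] (I : Submodule R R) (r : R) :
    R →ₗ[R] (↥(I ⊔ R ∙ r) ⧸ I.submoduleOf (I ⊔ R ∙ r)) :=
  (I.submoduleOf (I ⊔ R ∙ r)).mkQ.comp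
    (LinearMap.toSpanSingleton R ↥(I ⊔ R ∙ r)
      ⟨r, Submodule.mem_sup_right (Submodule.mem_span_singleton_self r)⟩)

theorem toQuotSup_surjective {R : Type*} [Ring R] (I : Submodule R R) (r : R) :
    Function.Surjective (toQuotSup I r) := by
  intro y
  obtain ⟨⟨y, hy⟩, rfl⟩ := Submodule.mkQ_surjective _ y
  obtain ⟨i, hi, z, hz, rfl⟩ := Submodule.mem_sup.1 hy
  obtain ⟨a, rfl⟩ := Submodule.mem_span_singleton.1 hz
  refine ⟨a, ?_⟩
  simp only [toQuotSup, LinearMap.comp_apply, Submodule.mkQ_apply]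
  rw [Submodule.Quotient.eq, Submodule.submoduleOf, Submodule.mem_comap]
  simpa using hi

theorem ker_toQuotSup {R : Type*} [Ring R] (I : Submodule R R) (r : R) :
    LinearMap.ker (toQuotSup I r) = I.comap (LinearMap.toSpanSingleton R R r) := by
  rw [toQuotSup, LinearMap.ker_comp, Submodule.ker_mkQ]
  rfl

/-- A ring is left coherent if and only if `(I : r)` is finitely generated for every finitely
generated left ideal `I` and every element `r`. -/
theorem isLeftCoherentRing_iff {R : Type*} [Ring R] :
    IsLeftCoherentRing R ↔ ∀ (I : Submodule R R), I.FG → ∀ r : R,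
      (I.comap (LinearMap.toSpanSingleton R R r)).FG := by
  constructor
  · intro h I hI r
    have := h.2 _ (hI.sup (Submodule.fg_span_singleton r))
    have hk : (I.submoduleOf (I ⊔ R ∙ r)).FG := by
      have e : ↥(I.submoduleOf (I ⊔ R ∙ r)) ≃ₗ[R] I := Submodule.submoduleOfEquivOfLe le_sup_left
      have : Module.Finite R I := Module.Finite.iff_fg.2 hI
      exact Module.Finite.iff_fg.1 (Module.Finite.equiv e.symm)
    have : Module.FinitePresentation R (↥(I ⊔ R ∙ r) ⧸ I.submoduleOf (I ⊔ R ∙ r)) :=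
      Module.finitePresentation_of_surjective (Submodule.mkQ _) (Submodule.mkQ_surjective _)
        (by rwa [Submodule.ker_mkQ])
    rw [← ker_toQuotSup]
    exact Module.FinitePresentation.fg_ker _ (toQuotSup_surjective I r)
  · intro h
    refine ⟨inferInstance, fun N hN => ?_⟩
    -- Adding one generator `r` extends `(I + R r) / I ≃ R / (I : r)` by `I`; both are finitely
    -- presented, hence so is `I + R r`.
    induction N, hN using Submodule.fg_sup_span_induction with
    | bot => exact Module.finitePresentation_of_projective R _
    | sup I r hI ih =>
      have : Module.FinitePresentation R (↥(I ⊔ R ∙ r) ⧸ I.submoduleOf (I ⊔ R ∙ r)) :=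
        Module.finitePresentation_of_surjective (toQuotSup I r) (toQuotSup_surjective I r)
          (by rw [ker_toQuotSup]; exact h I hI r)
      have e : ↥(I.submoduleOf (I ⊔ R ∙ r)) ≃ₗ[R] I := Submodule.submoduleOfEquivOfLe le_sup_left
      have : Module.FinitePresentation R (LinearMap.ker (I.submoduleOf (I ⊔ R ∙ r)).mkQ) := by
        rw [Submodule.ker_mkQ]
        exact Module.FinitePresentation.of_equiv e.symm
      exact Module.finitePresentation_of_ker (I.submoduleOf (I ⊔ R ∙ r)).mkQ
        (Submodule.mkQ_surjective _)

theorem IsLeftCoherentRing.of_ringEquiv {R S : Type*} [Ring R] [Ring S] (e : R ≃+* S)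
    (h : IsLeftCoherentRing R) : IsLeftCoherentRing S := by
  rw [isLeftCoherentRing_iff] at h ⊢
  intro J hJ s
  have : RingHomSurjective (e : R →+* S) := ⟨e.surjective⟩
  have : RingHomSurjective (e.symm : S →+* R) := ⟨e.symm.surjective⟩
  let f : R →ₛₗ[(e : R →+* S)] S := { toFun := e, map_add' := map_add e, map_smul' := map_mul e }
  let g : S →ₛₗ[(e.symm : S →+* R)] R :=
    { toFun := e.symm, map_add' := map_add e.symm, map_smul' := map_mul e.symm }
  have key := (h (J.map g) (hJ.map g) (e.symm s)).map f
  convert key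
  ext a
  simp only [Submodule.mem_comap, Submodule.mem_map, LinearMap.toSpanSingleton_apply, smul_eq_mul]
  constructor
  · intro ha
    exact ⟨e.symm a, ⟨_, ha, map_mul e.symm a s⟩, e.apply_symm_apply a⟩
  · rintro ⟨b, ⟨y, hy, hyb⟩, rfl⟩
    have : y = e b * s := by
      apply e.symm.injective
      rw [map_mul, e.symm_apply_apply]
      exact hyb
    change e b * s ∈ J
    rwa [← this]

theorem IsCoherentModule.of_linearEquiv {R M N : Type*} [Ring R] [AddCommGroup M] [Module R M]
    [AddCommGroup N] [Module R N] (e : M ≃ₗ[R] N) (h : IsCoherentModule R M) :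
    IsCoherentModule R N := by
  have := h.1
  refine ⟨Module.Finite.equiv e, fun L hL => ?_⟩
  have := h.2 (L.map (e.symm : N →ₗ[R] M)) (hL.map _)
  exact Module.FinitePresentation.of_equiv (e.symm.submoduleMap L).symm

/-- A ring is right coherent if and only if the opposite ring is left coherent. -/
theorem isRightCoherentRing_iff {R : Type*} [Ring R] :
    IsRightCoherentRing R ↔ IsLeftCoherentRing Rᵐᵒᵖ := by
  let e : R ≃ₗ[Rᵐᵒᵖ] Rᵐᵒᵖ :=
    { MulOpposite.opAddEquiv with map_smul' := fun _ _ => rfl }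
  exact ⟨fun h => h.of_linearEquiv e, fun h => h.of_linearEquiv e.symm⟩

theorem isLeftCoherentRing_iff_isRightCoherentRing {R : Type*} [Ring R] (e : R ≃+* Rᵐᵒᵖ) :
    IsLeftCoherentRing R ↔ IsRightCoherentRing R := by
  rw [isRightCoherentRing_iff]
  exact ⟨fun h => h.of_ringEquiv e, fun h => h.of_ringEquiv e.symm⟩

/-! ### Divided powers and the adjoint. -/

namespace IntegroDiff

variable (K : Type*) [Field K]

/-- `1 / s!` for a multi-index `s`. -/
def invFactorial {n : ℕ} (s : Fin n →₀ ℕ) : K := ∏ i, ((Nat.factorial (s i) : K))⁻¹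

theorem invFactorial_add_single [CharZero K] {n : ℕ} (s : Fin n →₀ ℕ) (i : Fin n) :
    invFactorial K (s + Finsupp.single i 1) = invFactorial K s / (s i + 1 : K) := by
  classical
  unfold invFactorial
  rw [Fintype.prod_eq_mul_prod_compl i, Fintype.prod_eq_mul_prod_compl i]
  have : ∀ j ∈ ({i}ᶜ : Finset (Fin n)),
      ((Nat.factorial ((s + Finsupp.single i 1 : Fin n →₀ ℕ) j) : K))⁻¹ =
        ((Nat.factorial (s j) : K))⁻¹ := by
    intro j hj
    have : i ≠ j := fun h => by simp [h] at hj
    simp [this]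
  rw [Finset.prod_congr rfl this]
  simp only [Finsupp.coe_add, Pi.add_apply, Finsupp.single_eq_same, Nat.factorial_succ]
  push_cast
  rw [mul_inv]
  ring

theorem invFactorial_ne_zero [CharZero K] {n : ℕ} (s : Fin n →₀ ℕ) : invFactorial K s ≠ 0 :=
  Finset.prod_ne_zero_iff.2 fun i _ => inv_ne_zero (by exact_mod_cast Nat.factorial_ne_zero (s i))

theorem mulX_mem {n : ℕ} (i : Fin n) : mulX K i ∈ algebraI K n := (x K i).2
theorem partialD_mem {n : ℕ} (i : Fin n) : partialD K i ∈ algebraI K n := (d K i).2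
theorem integral_mem {n : ℕ} (i : Fin n) : integral K i ∈ algebraI K n := (int K i).2

variable [CharZero K]

/-- The basis of divided powers `x^s / s!`. -/
def dpBasis (n : ℕ) : Module.Basis (Fin n →₀ ℕ) K (MvPolynomial (Fin n) K) :=
  (MvPolynomial.basisMonomials (Fin n) K).isUnitSMul (w := invFactorial K)
    fun s => (invFactorial_ne_zero K s).isUnit

variable {n : ℕ}

theorem dpBasis_apply (s : Fin n →₀ ℕ) :
    dpBasis K n s = MvPolynomial.monomial s (invFactorial K s) := by
  simp [dpBasis, Module.Basis.isUnitSMul_apply, MvPolynomial.smul_monomial]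

theorem integral_dpBasis (i : Fin n) (s : Fin n →₀ ℕ) :
    integral K i (dpBasis K n s) = dpBasis K n (s + Finsupp.single i 1) := by
  rw [dpBasis_apply, dpBasis_apply, integral_monomial, invFactorial_add_single]

theorem partialD_dpBasis_add (i : Fin n) (s : Fin n →₀ ℕ) :
    partialD K i (dpBasis K n (s + Finsupp.single i 1)) = dpBasis K n s := by
  rw [← integral_dpBasis, ← Module.End.mul_apply, partialD_mul_integral, Module.End.one_apply]

theorem partialD_dpBasis_of_eq_zero (i : Fin n) (s : Fin n →₀ ℕ) (h : s i = 0) :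
    partialD K i (dpBasis K n s) = 0 := by
  rw [dpBasis_apply]
  simp [partialD, MvPolynomial.pderiv_monomial, h]

theorem mulX_dpBasis (i : Fin n) (s : Fin n →₀ ℕ) :
    mulX K i (dpBasis K n s) = (s i + 1 : K) • dpBasis K n (s + Finsupp.single i 1) := by
  have h : (s i + 1 : K) ≠ 0 := by exact_mod_cast Nat.succ_ne_zero (s i)
  rw [dpBasis_apply, dpBasis_apply, invFactorial_add_single, MvPolynomial.smul_monomial,
    smul_eq_mul, mul_div_cancel₀ _ h, mulX, LinearMap.mulLeft_apply, MvPolynomial.X, MvPolynomial.monomial_mul,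
    one_mul, add_comm]

theorem exists_eq_add_single (i : Fin n) (s : Fin n →₀ ℕ) (h : s i ≠ 0) :
    ∃ t : Fin n →₀ ℕ, s = t + Finsupp.single i 1 :=
  ⟨s - Finsupp.single i 1, (tsub_add_cancel_of_le (by
    rw [Finsupp.single_le_iff]; exact Nat.one_le_iff_ne_zero.2 h)).symm⟩

/-- The symmetric bilinear form for which the divided powers are orthonormal. -/
def dpForm (n : ℕ) : LinearMap.BilinForm K (MvPolynomial (Fin n) K) :=
  (dpBasis K n).constr K fun s => (dpBasis K n).coord s

theorem dpForm_basis_left (s : Fin n →₀ ℕ) (u : MvPolynomial (Fin n) K) :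
    dpForm K n (dpBasis K n s) u = (dpBasis K n).repr u s := by
  simp [dpForm, Module.Basis.constr_basis]

theorem dpForm_basis [DecidableEq (Fin n →₀ ℕ)] (s t : Fin n →₀ ℕ) :
    dpForm K n (dpBasis K n s) (dpBasis K n t) = if s = t then 1 else 0 := by
  rw [dpForm_basis_left, Module.Basis.repr_self, Finsupp.single_apply]
  simp only [eq_comm]

theorem dpForm_comm (u v : MvPolynomial (Fin n) K) : dpForm K n u v = dpForm K n v u := by
  classical
  have : dpForm K n = (dpForm K n).flip := by
    refine (dpBasis K n).ext fun s => (dpBasis K n).ext fun t => ?_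
    change _ = dpForm K n (dpBasis K n t) (dpBasis K n s)
    rw [dpForm_basis, dpForm_basis]
    simp only [eq_comm]
  exact LinearMap.congr_fun₂ this u v

theorem dpForm_basis_right (s : Fin n →₀ ℕ) (u : MvPolynomial (Fin n) K) :
    dpForm K n u (dpBasis K n s) = (dpBasis K n).repr u s := by
  rw [dpForm_comm, dpForm_basis_left]

theorem eq_of_dpForm_left {u v : MvPolynomial (Fin n) K}
    (h : ∀ w, dpForm K n u w = dpForm K n v w) : u = v := by
  refine (dpBasis K n).repr.injective (Finsupp.ext fun s => ?_)
  rw [← dpForm_basis_right, h, dpForm_basis_right]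

theorem isAdjointPair_of_basis {f g : Module.End K (MvPolynomial (Fin n) K)}
    (h : ∀ s t, dpForm K n (f (dpBasis K n s)) (dpBasis K n t) =
      dpForm K n (dpBasis K n s) (g (dpBasis K n t))) :
    LinearMap.IsAdjointPair (dpForm K n) (dpForm K n) f g := by
  rw [LinearMap.isAdjointPair_iff_comp_eq_compl₂]
  exact (dpBasis K n).ext fun s => (dpBasis K n).ext fun t => h s t

theorem isAdjointPair_symm {f g : Module.End K (MvPolynomial (Fin n) K)}
    (h : LinearMap.IsAdjointPair (dpForm K n) (dpForm K n) f g) :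
    LinearMap.IsAdjointPair (dpForm K n) (dpForm K n) g f := fun u v => by
  rw [dpForm_comm, ← h, dpForm_comm]

theorem isAdjointPair_integral (i : Fin n) :
    LinearMap.IsAdjointPair (dpForm K n) (dpForm K n) (integral K i) (partialD K i) := by
  classical
  refine isAdjointPair_of_basis K fun s t => ?_
  rw [integral_dpBasis]
  by_cases h : t i = 0
  · rw [partialD_dpBasis_of_eq_zero K i t h, map_zero, dpForm_basis, if_neg]
    rintro rfl
    simp at h
  · obtain ⟨t, rfl⟩ := exists_eq_add_single i t h
    rw [partialD_dpBasis_add, dpForm_basis, dpForm_basis]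
    simp

/-- `x_i` raises the index with the factor `s_i + 1`, so its adjoint must lower it with the same
factor. Lowering, then applying `∂_i x_i`, which is diagonal with eigenvalue `s_i + 1`, does this
inside `𝕀_n`. -/
theorem isAdjointPair_mulX (i : Fin n) :
    LinearMap.IsAdjointPair (dpForm K n) (dpForm K n) (mulX K i)
      (partialD K i * mulX K i * partialD K i : Module.End K _) := by
  classical
  refine isAdjointPair_of_basis K fun s t => ?_
  rw [mulX_dpBasis, Module.End.mul_apply]
  by_cases h : t i = 0
  · rw [partialD_dpBasis_of_eq_zero K i t h, map_zero, map_zero, map_smul, LinearMap.smul_apply,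
      dpForm_basis, if_neg, smul_zero]
    rintro rfl
    simp at h
  · obtain ⟨t, rfl⟩ := exists_eq_add_single i t h
    rw [partialD_dpBasis_add, Module.End.mul_apply, mulX_dpBasis, map_smul, map_smul,
      partialD_dpBasis_add, map_smul, LinearMap.smul_apply, dpForm_basis, dpForm_basis]
    by_cases hst : s = t <;> simp [hst]

theorem exists_adjoint {a : Module.End K (MvPolynomial (Fin n) K)} (ha : a ∈ algebraI K n) :
    ∃ a' ∈ algebraI K n, LinearMap.IsAdjointPair (dpForm K n) (dpForm K n) a' a := by
  induction ha using Algebra.adjoin_induction with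
  | mem a ha =>
    rcases ha with (⟨i, rfl⟩ | ⟨i, rfl⟩) | ⟨i, rfl⟩
    · exact ⟨_, mul_mem (mul_mem (partialD_mem K i) (mulX_mem K i)) (partialD_mem K i),
        isAdjointPair_symm K (isAdjointPair_mulX K i)⟩
    · exact ⟨_, integral_mem K i, isAdjointPair_integral K i⟩
    · exact ⟨_, partialD_mem K i, isAdjointPair_symm K (isAdjointPair_integral K i)⟩
  | algebraMap r =>
    exact ⟨_, algebraMap_mem _ r, fun u v => by simp [Module.algebraMap_end_apply]⟩
  | add a b _ _ iha ihb =>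
    obtain ⟨a', ha', h⟩ := iha
    obtain ⟨b', hb', h'⟩ := ihb
    exact ⟨_, add_mem ha' hb', h.add h'⟩
  | mul a b _ _ iha ihb =>
    obtain ⟨a', ha', h⟩ := iha
    obtain ⟨b', hb', h'⟩ := ihb
    exact ⟨_, mul_mem hb' ha', h'.mul h⟩

/-- The adjoint of an element of `𝕀_n` with respect to the form `dpForm`. -/
def adj (a : algebraI K n) : algebraI K n :=
  ⟨(exists_adjoint K a.2).choose, (exists_adjoint K a.2).choose_spec.1⟩

theorem dpForm_adj (a : algebraI K n) (u v : MvPolynomial (Fin n) K) :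
    dpForm K n ((adj K a).1 u) v = dpForm K n u (a.1 v) :=
  (exists_adjoint K a.2).choose_spec.2 u v

/-- Nondegeneracy of the form makes the adjoint unique, so the algebraic identities for `adj` reduce
to checks on the form. -/
theorem adj_eq {a b : algebraI K n}
    (h : ∀ u v, dpForm K n (b.1 u) v = dpForm K n u (a.1 v)) : adj K a = b := by
  refine Subtype.ext (LinearMap.ext fun u => eq_of_dpForm_left K fun v => ?_)
  rw [dpForm_adj, h]

theorem adj_adj (a : algebraI K n) : adj K (adj K a) = a :=
  adj_eq K fun u v => by rw [dpForm_comm, ← dpForm_adj, dpForm_comm]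

theorem adj_mul (a b : algebraI K n) : adj K (a * b) = adj K b * adj K a :=
  adj_eq K fun u v => by
    simp only [MulMemClass.coe_mul, Module.End.mul_apply, dpForm_adj]

theorem adj_add (a b : algebraI K n) : adj K (a + b) = adj K a + adj K b :=
  adj_eq K fun u v => by
    simp only [AddMemClass.coe_add, LinearMap.add_apply, map_add, dpForm_adj]

theorem adj_zero : adj K (0 : algebraI K n) = 0 := adj_eq K fun u v => by simp

/-- The adjoint as an isomorphism of `𝕀_n` with its opposite ring. -/
def adjEquiv (n : ℕ) : algebraI K n ≃+* (algebraI K n)ᵐᵒᵖ where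
  toFun a := MulOpposite.op (adj K a)
  invFun a := adj K a.unop
  left_inv a := adj_adj K a
  right_inv a := congrArg MulOpposite.op (adj_adj K a.unop)
  map_mul' a b := by rw [adj_mul]; rfl
  map_add' a b := by rw [adj_add]; rfl

end IntegroDiff

/-! ### One variable: symbols of operators. -/

namespace IntegroDiff

variable (K : Type*) [Field K] [CharZero K]

/-- The basis of divided powers of the polynomials in one variable, indexed by `ℕ`. -/
def dpBasisOne : Module.Basis ℕ K (MvPolynomial (Fin 1) K) :=
  (dpBasis K 1).reindex (Finsupp.uniqueEquiv (0 : Fin 1))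

theorem dpBasisOne_apply (j : ℕ) : dpBasisOne K j = dpBasis K 1 (Finsupp.single 0 j) := by
  rw [dpBasisOne, Module.Basis.reindex_apply]
  congr 1

theorem integral_dpBasisOne (j : ℕ) : integral K 0 (dpBasisOne K j) = dpBasisOne K (j + 1) := by
  rw [dpBasisOne_apply, dpBasisOne_apply, integral_dpBasis, ← Finsupp.single_add]

theorem partialD_dpBasisOne_succ (j : ℕ) :
    partialD K 0 (dpBasisOne K (j + 1)) = dpBasisOne K j := by
  rw [dpBasisOne_apply, dpBasisOne_apply, Finsupp.single_add, partialD_dpBasis_add]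

theorem partialD_dpBasisOne_zero : partialD K 0 (dpBasisOne K 0) = 0 := by
  rw [dpBasisOne_apply, partialD_dpBasis_of_eq_zero]
  simp

theorem mulX_dpBasisOne (j : ℕ) :
    mulX K 0 (dpBasisOne K j) = (j + 1 : K) • dpBasisOne K (j + 1) := by
  rw [dpBasisOne_apply, dpBasisOne_apply, mulX_dpBasis, ← Finsupp.single_add]
  simp

theorem dpForm_dpBasisOne_left (j : ℕ) (u : MvPolynomial (Fin 1) K) :
    dpForm K 1 (dpBasisOne K j) u = (dpBasisOne K).repr u j := by
  rw [dpBasisOne_apply, dpForm_basis_left, dpBasisOne, Module.Basis.repr_reindex_apply]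
  congr 1

variable {K}

theorem repr_integral_zero (v : MvPolynomial (Fin 1) K) :
    (dpBasisOne K).repr (integral K 0 v) 0 = 0 := by
  have : (dpBasisOne K).coord 0 ∘ₗ integral K 0 = 0 :=
    (dpBasisOne K).ext fun j => by simp [integral_dpBasisOne]
  exact LinearMap.congr_fun this v

theorem repr_integral_succ (v : MvPolynomial (Fin 1) K) (i : ℕ) :
    (dpBasisOne K).repr (integral K 0 v) (i + 1) = (dpBasisOne K).repr v i := by
  have : (dpBasisOne K).coord (i + 1) ∘ₗ integral K 0 = (dpBasisOne K).coord i :=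
    (dpBasisOne K).ext fun j => by simp [integral_dpBasisOne, Finsupp.single_apply]
  exact LinearMap.congr_fun this v

theorem repr_partialD (v : MvPolynomial (Fin 1) K) (i : ℕ) :
    (dpBasisOne K).repr (partialD K 0 v) i = (dpBasisOne K).repr v (i + 1) := by
  have : (dpBasisOne K).coord i ∘ₗ partialD K 0 = (dpBasisOne K).coord (i + 1) :=
    (dpBasisOne K).ext fun j => by
      cases j with
      | zero => simp [partialD_dpBasisOne_zero]
      | succ j => simp [partialD_dpBasisOne_succ, Finsupp.single_apply]
  exact LinearMap.congr_fun this v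

theorem repr_euler (v : MvPolynomial (Fin 1) K) (i : ℕ) :
    (dpBasisOne K).repr ((mulX K 0 * partialD K 0 : Module.End K _) v) i =
      i * (dpBasisOne K).repr v i := by
  have : (dpBasisOne K).coord i ∘ₗ (mulX K 0 * partialD K 0) = (i : K) • (dpBasisOne K).coord i :=
    (dpBasisOne K).ext fun j => by
      cases j with
      | zero =>
        rcases eq_or_ne i 0 with rfl | h
        · simp [partialD_dpBasisOne_zero]
        · simp [partialD_dpBasisOne_zero, h.symm]
      | succ j =>
        rcases eq_or_ne (j + 1) i with rfl | h
        · simp [partialD_dpBasisOne_succ, mulX_dpBasisOne]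
        · simp [partialD_dpBasisOne_succ, mulX_dpBasisOne, h]
  exact LinearMap.congr_fun this v

open Polynomial in
theorem repr_aeval_euler (f : K[X]) (v : MvPolynomial (Fin 1) K) (i : ℕ) :
    (dpBasisOne K).repr (aeval (mulX K 0 * partialD K 0 : Module.End K _) f v) i =
      f.eval (i : K) * (dpBasisOne K).repr v i := by
  induction f using Polynomial.induction_on generalizing v with
  | C a => simp [Module.algebraMap_end_apply]
  | add p q hp hq => simp [add_mul, hp, hq]
  | monomial k a h =>
    rw [pow_succ, ← mul_assoc, map_mul, Module.End.mul_apply, aeval_X, h, repr_euler]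
    simp
    ring

/-- Reduces the generator `x` to the diagonal operator `x∂` and the shift `∫`, whose effects on
symbols are immediate. -/
theorem mulX_eq : mulX K (0 : Fin 1) = mulX K 0 * partialD K 0 * integral K 0 := by
  rw [mul_assoc, partialD_mul_integral, mul_one]

open Polynomial

/-- `p` is the symbol of the operator `a`: for large `j`, the coefficient of `x^i / i!` in
`a (x^j / j!)` is `p_{i - j}(i)`. -/
def HasSymbol (a : Module.End K (MvPolynomial (Fin 1) K)) (p : ℤ → K[X]) : Prop :=
  ∃ N : ℕ, (∀ t : ℤ, N ≤ |t| → p t = 0) ∧ ∀ j ≥ N, ∀ i : ℕ,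
    (dpBasisOne K).repr (a (dpBasisOne K j)) i = (p ((i : ℤ) - j)).eval (i : K)

/-- The effect on symbols of a shift by `k`. -/
def shiftSymbol (k : ℤ) (p : ℤ → K[X]) : ℤ → K[X] := fun t => (p (t - k)).comp (X - C (k : K))

theorem HasSymbol.zero : HasSymbol (0 : Module.End K (MvPolynomial (Fin 1) K)) 0 :=
  ⟨0, by simp, by simp⟩

theorem HasSymbol.one : HasSymbol (1 : Module.End K (MvPolynomial (Fin 1) K))
    (fun t => if t = 0 then 1 else 0) := by
  refine ⟨1, fun t ht => if_neg ?_, fun j _ i => ?_⟩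
  · rintro rfl
    simp at ht
  · rcases eq_or_ne j i with rfl | h
    · simp
    · have h' : (i : ℤ) - j ≠ 0 := by omega
      simp [h, h']

theorem HasSymbol.add {a c : Module.End K (MvPolynomial (Fin 1) K)} {p q : ℤ → K[X]}
    (ha : HasSymbol a p) (hc : HasSymbol c q) : HasSymbol (a + c) (p + q) := by
  obtain ⟨N, h1, h2⟩ := ha
  obtain ⟨M, h3, h4⟩ := hc
  refine ⟨max N M, fun t ht => ?_, fun j hj i => ?_⟩
  · rw [Pi.add_apply, h1 t (le_trans (by simp) ht), h3 t (le_trans (by simp) ht), add_zero]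
  · simp [h2 j (le_trans (le_max_left _ _) hj), h4 j (le_trans (le_max_right _ _) hj)]

theorem HasSymbol.aeval_mul {a : Module.End K (MvPolynomial (Fin 1) K)} {p : ℤ → K[X]}
    (ha : HasSymbol a p) (f : K[X]) :
    HasSymbol (aeval (mulX K 0 * partialD K 0 : Module.End K _) f * a) (fun t => f * p t) := by
  obtain ⟨N, h1, h2⟩ := ha
  refine ⟨N, fun t ht => by simp [h1 t ht], fun j hj i => ?_⟩
  rw [Module.End.mul_apply, repr_aeval_euler, h2 j hj, eval_mul]

theorem HasSymbol.euler_mul {a : Module.End K (MvPolynomial (Fin 1) K)} {p : ℤ → K[X]}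
    (ha : HasSymbol a p) :
    HasSymbol (mulX K 0 * partialD K 0 * a) (fun t => X * p t) := by
  simpa using ha.aeval_mul X

/-- Row `i + 1` of `∫ a` is row `i` of `a`, so the polynomial of degree `t - 1` gets evaluated one
step lower. -/
theorem HasSymbol.integral_mul {a : Module.End K (MvPolynomial (Fin 1) K)} {p : ℤ → K[X]}
    (ha : HasSymbol a p) : HasSymbol (integral K 0 * a) (shiftSymbol 1 p) := by
  obtain ⟨N, h1, h2⟩ := ha
  refine ⟨N + 1, fun t ht => ?_, fun j hj i => ?_⟩
  · have : (N : ℤ) ≤ |t - 1| := by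
      rcases abs_cases t with h | h <;> rcases abs_cases (t - 1) with h' | h' <;>
        push_cast at ht <;> omega
    rw [shiftSymbol, h1 _ this, zero_comp]
  · rw [Module.End.mul_apply]
    cases i with
    | zero =>
      -- Row `0` has no predecessor; here the symbol is taken at `-j - 1`, outside its support.
      rw [repr_integral_zero, shiftSymbol, h1 _ (by rw [abs_of_nonpos] <;> push_cast <;> omega)]
      simp
    | succ i =>
      rw [repr_integral_succ, h2 j (by omega), shiftSymbol, eval_comp]
      simp only [Nat.cast_add, Nat.cast_one, Int.cast_one, map_one, eval_sub, eval_X, eval_one,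
        add_sub_cancel_right]
      congr 2
      omega

theorem HasSymbol.partialD_mul {a : Module.End K (MvPolynomial (Fin 1) K)} {p : ℤ → K[X]}
    (ha : HasSymbol a p) : HasSymbol (partialD K 0 * a) (shiftSymbol (-1) p) := by
  obtain ⟨N, h1, h2⟩ := ha
  refine ⟨N + 1, fun t ht => ?_, fun j hj i => ?_⟩
  · have : (N : ℤ) ≤ |t - -1| := by
      rcases abs_cases t with h | h <;> rcases abs_cases (t - -1) with h' | h' <;>
        push_cast at ht <;> omega
    rw [shiftSymbol, h1 _ this, zero_comp]
  · rw [Module.End.mul_apply, repr_partialD, h2 j (by omega), shiftSymbol, eval_comp]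
    simp only [Nat.cast_add, Nat.cast_one, Int.cast_neg, Int.cast_one, map_neg, map_one,
      sub_neg_eq_add, eval_add, eval_X, eval_one]
    congr 2
    omega

omit [CharZero K] in
theorem shiftSymbol_add (k l : ℤ) (p : ℤ → K[X]) :
    shiftSymbol k (shiftSymbol l p) = shiftSymbol (k + l) p := by
  funext t
  simp only [shiftSymbol, comp_assoc, sub_comp, X_comp, C_comp]
  congr 1
  · congr 1
    ring
  · push_cast
    rw [C_add]
    ring

omit [CharZero K] in
theorem shiftSymbol_zero (p : ℤ → K[X]) : shiftSymbol 0 p = p := by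
  funext t
  simp [shiftSymbol]

theorem HasSymbol.integral_pow_mul {a : Module.End K (MvPolynomial (Fin 1) K)} {p : ℤ → K[X]}
    (ha : HasSymbol a p) (k : ℕ) : HasSymbol (integral K 0 ^ k * a) (shiftSymbol k p) := by
  induction k with
  | zero => simpa [shiftSymbol_zero] using ha
  | succ k ih =>
    rw [pow_succ', mul_assoc]
    convert ih.integral_mul using 1
    rw [shiftSymbol_add]
    push_cast
    rw [add_comm]

theorem HasSymbol.partialD_pow_mul {a : Module.End K (MvPolynomial (Fin 1) K)} {p : ℤ → K[X]}
    (ha : HasSymbol a p) (k : ℕ) : HasSymbol (partialD K 0 ^ k * a) (shiftSymbol (-k) p) := by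
  induction k with
  | zero => simpa [shiftSymbol_zero] using ha
  | succ k ih =>
    rw [pow_succ', mul_assoc]
    convert ih.partialD_mul using 1
    rw [shiftSymbol_add]
    push_cast
    rw [neg_add, add_comm]

theorem HasSymbol.sub {a c : Module.End K (MvPolynomial (Fin 1) K)} {p q : ℤ → K[X]}
    (ha : HasSymbol a p) (hc : HasSymbol c q) : HasSymbol (a - c) (p - q) := by
  have h : HasSymbol (-c) (-q) := by
    convert hc.aeval_mul (-1) using 1
    · rw [map_neg, map_one]
      exact (neg_one_mul c).symm
    · funext t
      simp
  rw [sub_eq_add_neg, sub_eq_add_neg]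
  exact ha.add h

/-- Quantifying over the right factor `c` lets the induction over products go through with the rules
for generators only, without a product formula for symbols. -/
theorem exists_hasSymbol_mul {a : Module.End K (MvPolynomial (Fin 1) K)} (ha : a ∈ algebraI K 1) :
    ∀ c, (∃ p, HasSymbol c p) → ∃ p, HasSymbol (a * c) p := by
  induction ha using Algebra.adjoin_induction with
  | mem a ha =>
    rintro c ⟨p, hp⟩
    rcases ha with (⟨i, rfl⟩ | ⟨i, rfl⟩) | ⟨i, rfl⟩ <;> obtain rfl : i = 0 := Subsingleton.elim _ _
    · rw [mulX_eq, mul_assoc]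
      exact ⟨_, hp.integral_mul.euler_mul⟩
    · exact ⟨_, hp.partialD_mul⟩
    · exact ⟨_, hp.integral_mul⟩
  | algebraMap r =>
    rintro c ⟨p, hp⟩
    exact ⟨_, by simpa using hp.aeval_mul (C r)⟩
  | add a b _ _ iha ihb =>
    intro c hc
    obtain ⟨p, hp⟩ := iha c hc
    obtain ⟨q, hq⟩ := ihb c hc
    exact ⟨_, by rw [add_mul]; exact hp.add hq⟩
  | mul a b _ _ iha ihb =>
    intro c hc
    rw [mul_assoc]
    exact iha _ (ihb c hc)

theorem exists_hasSymbol (a : algebraI K 1) : ∃ p, HasSymbol a.1 p := by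
  simpa using exists_hasSymbol_mul a.2 1 ⟨_, HasSymbol.one⟩

end IntegroDiff

/-! ### Leading degrees and the ideal of finite rank operators. -/

namespace IntegroDiff

variable {K : Type*} [Field K] [CharZero K]

open Polynomial

/-- For large `j` the operator `a` sends `x^j / j!` to a polynomial of degree `j + t`. -/
def HasLead (a : Module.End K (MvPolynomial (Fin 1) K)) (t : ℤ) : Prop :=
  ∃ N : ℕ, ∀ j ≥ N, 0 ≤ (j : ℤ) + t ∧
    (∀ i : ℕ, (j : ℤ) + t < i → (dpBasisOne K).repr (a (dpBasisOne K j)) i = 0) ∧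
    (∀ i : ℕ, (j : ℤ) + t = i → (dpBasisOne K).repr (a (dpBasisOne K j)) i ≠ 0)

/-- The operator `a` annihilates `x^j` for all large `j`. -/
def EventuallyZero (a : Module.End K (MvPolynomial (Fin 1) K)) : Prop :=
  ∃ N : ℕ, ∀ j ≥ N, a (dpBasisOne K j) = 0

theorem HasSymbol.eventuallyZero {a : Module.End K (MvPolynomial (Fin 1) K)}
    (h : HasSymbol a 0) : EventuallyZero a := by
  obtain ⟨N, -, h⟩ := h
  refine ⟨N, fun j hj => (dpBasisOne K).repr.injective (Finsupp.ext fun i => ?_)⟩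
  rw [h j hj i]
  simp

theorem exists_forall_eval_ne_zero {f : K[X]} (hf : f ≠ 0) :
    ∃ N : ℕ, ∀ i : ℕ, N ≤ i → f.eval (i : K) ≠ 0 := by
  classical
  have hfin : {i : ℕ | f.eval (i : K) = 0}.Finite := by
    refine Set.Finite.of_finite_image (f := fun i : ℕ => (i : K)) ?_ Nat.cast_injective.injOn
    refine (f.roots.toFinset.finite_toSet).subset ?_
    rintro _ ⟨i, hi, rfl⟩
    simpa [hf] using hi
  obtain ⟨M, hM⟩ := hfin.bddAbove
  exact ⟨M + 1, fun i hi h => absurd (hM h) (by omega)⟩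

/-- The leading degree is the largest `t` with `p t ≠ 0`: beyond the natural roots of `p t` the
leading coefficient does not vanish. -/
theorem HasSymbol.exists_hasLead {a : Module.End K (MvPolynomial (Fin 1) K)} {p : ℤ → K[X]}
    (h : HasSymbol a p) (hp : p ≠ 0) : ∃ t, HasLead a t := by
  obtain ⟨N, h1, h2⟩ := h
  obtain ⟨s, hs⟩ := Function.ne_iff.1 hp
  obtain ⟨t, ht, hmax⟩ := Int.exists_greatest_of_bdd (P := fun t => p t ≠ 0)
    ⟨N, fun t ht => by
      by_contra hlt
      exact ht (h1 t ((not_le.1 hlt).le.trans (le_abs_self t)))⟩ ⟨s, hs⟩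
  obtain ⟨M, hM⟩ := exists_forall_eval_ne_zero ht
  -- `N` makes the symbol valid; `M + |t|` ensures that `j + t` is nonnegative and past the roots of
  -- `p t`.
  refine ⟨t, N + M + t.natAbs, fun j hj => ⟨by omega, fun i hi => ?_, fun i hi => ?_⟩⟩
  · rw [h2 j (by omega)]
    have : p ((i : ℤ) - j) = 0 := by
      by_contra hne
      have := hmax _ hne
      omega
    simp [this]
  · rw [h2 j (by omega), ← hi, add_sub_cancel_left]
    exact hM i (by omega)

theorem eventuallyZero_or_hasLead (a : algebraI K 1) :
    EventuallyZero a.1 ∨ ∃ t, HasLead a.1 t := by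
  obtain ⟨p, hp⟩ := exists_hasSymbol a
  by_cases h : p = 0
  · exact Or.inl (h ▸ hp).eventuallyZero
  · exact Or.inr (hp.exists_hasLead h)

/-- The polynomials of degree less than `m`. -/
def spanLT (K : Type*) [Field K] [CharZero K] (m : ℕ) : Submodule K (MvPolynomial (Fin 1) K) :=
  Submodule.span K (dpBasisOne K '' Set.Iio m)

theorem mem_spanLT {m : ℕ} {v : MvPolynomial (Fin 1) K} :
    v ∈ spanLT K m ↔ ∀ i ≥ m, (dpBasisOne K).repr v i = 0 := by
  rw [spanLT, Module.Basis.mem_span_image]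
  constructor
  · intro h i hi
    by_contra hne
    have := h (Finsupp.mem_support_iff.2 hne)
    rw [Set.mem_Iio] at this
    omega
  · intro h i hi
    rw [Finset.mem_coe, Finsupp.mem_support_iff] at hi
    by_contra hlt
    exact hi (h i (not_lt.1 hlt))

instance finite_spanLT (m : ℕ) : FiniteDimensional K (spanLT K m) :=
  FiniteDimensional.span_of_finite K ((Set.finite_Iio m).image _)

theorem exists_mem_spanLT (v : MvPolynomial (Fin 1) K) : ∃ m, v ∈ spanLT K m := by
  obtain ⟨M, hM⟩ := ((dpBasisOne K).repr v).support.finite_toSet.bddAbove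
  refine ⟨M + 1, mem_spanLT.2 fun i hi => ?_⟩
  by_contra hne
  exact absurd (hM (Finsupp.mem_support_iff.2 hne)) (by omega)

/-- Each basis vector of large degree `i` is, up to a scalar and lower terms, the image of the one
of degree `i - t`; induction on the degree absorbs the lower terms. -/
theorem HasLead.exists_sup_range {a : Module.End K (MvPolynomial (Fin 1) K)} {t : ℤ}
    (h : HasLead a t) : ∃ m, spanLT K m ⊔ LinearMap.range a = ⊤ := by
  obtain ⟨N, h⟩ := h
  refine ⟨N + t.natAbs, eq_top_iff.2 fun v _ => ?_⟩
  suffices H : ∀ m, spanLT K m ≤ spanLT K (N + t.natAbs) ⊔ LinearMap.range a by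
    obtain ⟨m, hm⟩ := exists_mem_spanLT v
    exact H m hm
  intro m
  induction m with
  | zero => simp [spanLT]
  | succ m ih =>
    refine Submodule.span_le.2 ?_
    rintro _ ⟨i, hi, rfl⟩
    rcases Nat.lt_succ_iff_lt_or_eq.1 hi with hi | rfl
    · exact ih (Submodule.subset_span ⟨i, hi, rfl⟩)
    · by_cases hs : i < N + t.natAbs
      · exact Submodule.mem_sup_left (Submodule.subset_span ⟨i, hs, rfl⟩)
      · obtain ⟨j, hj⟩ : ∃ j : ℕ, (j : ℤ) = i - t := ⟨((i : ℤ) - t).toNat, by omega⟩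
        obtain ⟨-, h1, h2⟩ := h j (by omega)
        set c := (dpBasisOne K).repr (a (dpBasisOne K j)) i with hc
        have hc0 : c ≠ 0 := h2 i (by omega)
        have hlow : a (dpBasisOne K j) - c • dpBasisOne K i ∈ spanLT K i := by
          rw [mem_spanLT]
          intro k hk
          rcases hk.lt_or_eq with hk | rfl
          · simp [h1 k (by omega), hk.ne]
          · simp [hc]
        have : dpBasisOne K i = c⁻¹ • (a (dpBasisOne K j) -
            (a (dpBasisOne K j) - c • dpBasisOne K i)) := by
          rw [sub_sub_cancel, smul_smul, inv_mul_cancel₀ hc0, one_smul]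
        rw [this]
        exact Submodule.smul_mem _ _ (Submodule.sub_mem _
          (Submodule.mem_sup_right ⟨_, rfl⟩) (ih hlow))

/-- The first `N` coordinates determine a kernel element: if they vanish, the top term of a nonzero
`u` survives in `a u`. -/
theorem HasLead.finite_ker {a : Module.End K (MvPolynomial (Fin 1) K)} {t : ℤ}
    (h : HasLead a t) : FiniteDimensional K (LinearMap.ker a) := by
  obtain ⟨N, h⟩ := h
  let f : LinearMap.ker a →ₗ[K] (Fin N → K) :=
    (LinearMap.pi fun i : Fin N => (dpBasisOne K).coord i).comp (LinearMap.ker a).subtype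
  refine FiniteDimensional.of_injective f ((injective_iff_map_eq_zero f).2 ?_)
  rintro ⟨u, hu⟩ hfu
  have hlow : ∀ i < N, (dpBasisOne K).repr u i = 0 := fun i hi => congrFun hfu ⟨i, hi⟩
  by_contra hne
  have hne : u ≠ 0 := fun h => hne (Subtype.ext h)
  have hsupp : ((dpBasisOne K).repr u).support.Nonempty := by
    rw [Finsupp.support_nonempty_iff]
    simpa using hne
  set m := ((dpBasisOne K).repr u).support.max' hsupp with hm
  have hmem : m ∈ ((dpBasisOne K).repr u).support := Finset.max'_mem _ _
  have hmN : N ≤ m := by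
    by_contra hlt
    exact Finsupp.mem_support_iff.1 hmem (hlow m (not_le.1 hlt))
  obtain ⟨h0, h1, h2⟩ := h m hmN
  obtain ⟨i, hi⟩ := Int.eq_ofNat_of_zero_le h0
  have hau : (dpBasisOne K).repr (a u) i = 0 := by
    rw [LinearMap.mem_ker.1 hu]
    simp
  have hsum : (dpBasisOne K).repr (a u) i = ∑ j ∈ ((dpBasisOne K).repr u).support,
      (dpBasisOne K).repr u j * (dpBasisOne K).repr (a (dpBasisOne K j)) i := by
    conv_lhs => rw [← (dpBasisOne K).linearCombination_repr u, Finsupp.linearCombination_apply,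
      Finsupp.sum, map_sum, map_sum]
    simp
  rw [hsum, Finset.sum_eq_single_of_mem m hmem] at hau
  · exact (mul_ne_zero (Finsupp.mem_support_iff.1 hmem) (h2 i hi)) hau
  · intro j hj hjm
    have hjN : N ≤ j := by
      by_contra hlt
      exact Finsupp.mem_support_iff.1 hj (hlow j (not_le.1 hlt))
    have : j ≤ m := Finset.le_max' _ _ hj
    rw [(h j hjN).2.1 i (by omega), mul_zero]

theorem EventuallyZero.finite_range {a : Module.End K (MvPolynomial (Fin 1) K)}
    (h : EventuallyZero a) : FiniteDimensional K (LinearMap.range a) := by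
  obtain ⟨N, h⟩ := h
  have : LinearMap.range a ≤ (spanLT K N).map a := by
    rw [LinearMap.range_eq_map, ← (dpBasisOne K).span_eq, Submodule.map_span, Submodule.span_le]
    rintro _ ⟨_, ⟨j, rfl⟩, rfl⟩
    by_cases hj : N ≤ j
    · rw [h j hj]
      exact Submodule.zero_mem _
    · exact ⟨_, Submodule.subset_span ⟨j, not_le.1 hj, rfl⟩, rfl⟩
  exact Submodule.finiteDimensional_of_le this

theorem not_finite_range_of_finite_ker {a : Module.End K (MvPolynomial (Fin 1) K)}
    (h : FiniteDimensional K (LinearMap.ker a)) : ¬ FiniteDimensional K (LinearMap.range a) := by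
  intro h'
  have : FiniteDimensional K (MvPolynomial (Fin 1) K ⧸ LinearMap.ker a) :=
    Module.Finite.equiv a.quotKerEquivRange.symm
  have : FiniteDimensional K (MvPolynomial (Fin 1) K) :=
    Module.Finite.of_submodule_quotient (LinearMap.ker a)
  exact not_finite_iff_infinite.2 (inferInstance : Infinite ℕ)
    (Module.Finite.finite_basis (dpBasisOne K))

variable (K) in
/-- The left ideal of operators of finite rank in `𝕀_1`. -/
def finiteRank : LeftIdeal (algebraI K 1) where
  carrier := {a | FiniteDimensional K (LinearMap.range a.1)}
  zero_mem' := by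
    change FiniteDimensional K (LinearMap.range (0 : Module.End K (MvPolynomial (Fin 1) K)))
    rw [LinearMap.range_zero]
    infer_instance
  add_mem' {a b} ha hb := by
    have : FiniteDimensional K (LinearMap.range a.1) := ha
    have : FiniteDimensional K (LinearMap.range b.1) := hb
    exact Submodule.finiteDimensional_of_le (LinearMap.range_add_le a.1 b.1)
  smul_mem' c a ha := by
    have : FiniteDimensional K (LinearMap.range a.1) := ha
    change FiniteDimensional K (LinearMap.range (c.1 ∘ₗ a.1))
    rw [LinearMap.range_comp]
    infer_instance

omit [CharZero K] in
theorem mem_finiteRank {a : algebraI K 1} :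
    a ∈ finiteRank K ↔ FiniteDimensional K (LinearMap.range a.1) := Iff.rfl

theorem mem_finiteRank_iff_eventuallyZero {a : algebraI K 1} :
    a ∈ finiteRank K ↔ EventuallyZero a.1 := by
  refine ⟨fun h => ?_, fun h => h.finite_range⟩
  rcases eventuallyZero_or_hasLead a with h' | ⟨t, ht⟩
  · exact h'
  · exact absurd h (not_finite_range_of_finite_ker ht.finite_ker)

theorem exists_hasLead_of_notMem {a : algebraI K 1} (h : a ∉ finiteRank K) :
    ∃ t, HasLead a.1 t := by
  rw [mem_finiteRank_iff_eventuallyZero] at h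
  exact (eventuallyZero_or_hasLead a).resolve_left h

omit [CharZero K] in
theorem mul_mem_finiteRank {a : algebraI K 1} (h : a ∈ finiteRank K) (r : algebraI K 1) :
    a * r ∈ finiteRank K := by
  rw [mem_finiteRank] at h ⊢
  exact Submodule.finiteDimensional_of_le (LinearMap.range_comp_le_range r.1 a.1)

/-- The range of `r` has finite codimension, so the range of `a` exceeds that of `a r` by a
finite-dimensional space only. -/
theorem mem_finiteRank_of_mul {a r : algebraI K 1} (h : a * r ∈ finiteRank K)
    (hr : r ∉ finiteRank K) : a ∈ finiteRank K := by
  obtain ⟨t, ht⟩ := exists_hasLead_of_notMem hr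
  obtain ⟨m, hm⟩ := ht.exists_sup_range
  rw [mem_finiteRank] at h ⊢
  have h : FiniteDimensional K (LinearMap.range (a.1 ∘ₗ r.1)) := h
  rw [LinearMap.range_comp] at h
  rw [LinearMap.range_eq_map, ← hm, Submodule.map_sup]
  infer_instance

theorem one_notMem_finiteRank : (1 : algebraI K 1) ∉ finiteRank K := by
  refine not_finite_range_of_finite_ker ?_
  have : LinearMap.ker (1 : algebraI K 1).1 = ⊥ := LinearMap.ker_eq_bot.2 fun _ _ h => h
  rw [this]
  infer_instance

end IntegroDiff

/-! ### The quotient by finite rank operators is left Noetherian. -/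

namespace IntegroDiff

variable {K : Type*} [Field K] [CharZero K]

open Polynomial

/-- `f(x∂)` as an element of `𝕀_1`. -/
def eulerPoly (f : K[X]) : algebraI K 1 := aeval (x K 0 * d K 0) f

omit [CharZero K] in
theorem coe_eulerPoly (f : K[X]) :
    (eulerPoly f).1 = aeval (mulX K 0 * partialD K 0 : Module.End K _) f :=
  (aeval_algHom_apply (algebraI K 1).val (x K 0 * d K 0) f).symm

theorem HasSymbol.eulerPoly_mul {a : algebraI K 1} {p : ℤ → K[X]} (h : HasSymbol a.1 p)
    (f : K[X]) : HasSymbol (eulerPoly f * a).1 (fun t => f * p t) := by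
  rw [MulMemClass.coe_mul, coe_eulerPoly]
  exact h.aeval_mul f

theorem HasSymbol.int_pow_mul {a : algebraI K 1} {p : ℤ → K[X]} (h : HasSymbol a.1 p)
    (k : ℕ) : HasSymbol (int K 0 ^ k * a).1 (shiftSymbol k p) :=
  h.integral_pow_mul k

theorem HasSymbol.d_pow_mul {a : algebraI K 1} {p : ℤ → K[X]} (h : HasSymbol a.1 p)
    (k : ℕ) : HasSymbol (d K 0 ^ k * a).1 (shiftSymbol (-k) p) :=
  h.partialD_pow_mul k

theorem d_mul_int : d K (0 : Fin 1) * int K 0 = 1 := Subtype.ext (partialD_mul_integral K 0)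

theorem d_pow_mul_int_pow (k : ℕ) : d K (0 : Fin 1) ^ k * int K 0 ^ k = 1 := by
  induction k with
  | zero => simp
  | succ k ih =>
    rw [pow_succ, pow_succ', mul_assoc, ← mul_assoc (d K 0) (int K 0), d_mul_int, one_mul, ih]

/-- The leading coefficients of the elements of a left ideal, normalized to degree zero. -/
def leadingIdeal (L : LeftIdeal (algebraI K 1)) : Ideal K[X] where
  carrier := {g | ∃ a ∈ L, ∃ p, HasSymbol a.1 p ∧ (∀ t > 0, p t = 0) ∧ p 0 = g}
  zero_mem' := ⟨0, L.zero_mem, 0, HasSymbol.zero, by simp, rfl⟩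
  add_mem' := by
    rintro _ _ ⟨a, ha, p, hp, h1, rfl⟩ ⟨b, hb, q, hq, h2, rfl⟩
    exact ⟨a + b, L.add_mem ha hb, p + q, hp.add hq,
      fun t ht => by simp [h1 t ht, h2 t ht], rfl⟩
  smul_mem' := by
    rintro f _ ⟨a, ha, p, hp, h1, rfl⟩
    exact ⟨eulerPoly f * a, L.smul_mem _ ha, _, hp.eulerPoly_mul f,
      fun t ht => by simp [h1 t ht], rfl⟩

/-- Extension by zero of a tuple of coefficients to a symbol. -/
def symbolOfFin {m : ℕ} (q : Fin m → K[X]) : ℤ → K[X] :=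
  fun t => if h : 0 ≤ t ∧ t < m then q ⟨t.toNat, by omega⟩ else 0

/-- The symbols of degrees in `[0, m)` of the elements of a left ideal. -/
def boundedSymbols (L : LeftIdeal (algebraI K 1)) (m : ℕ) :
    Submodule K[X] (Fin m → K[X]) where
  carrier := {q | ∃ a ∈ L, HasSymbol a.1 (symbolOfFin q)}
  zero_mem' := ⟨0, L.zero_mem, by
    change HasSymbol 0 _
    convert HasSymbol.zero (K := K) using 1
    funext t
    simp [symbolOfFin]⟩
  add_mem' := by
    rintro q q' ⟨a, ha, hq⟩ ⟨b, hb, hq'⟩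
    refine ⟨a + b, L.add_mem ha hb, ?_⟩
    change HasSymbol (a.1 + b.1) _
    convert hq.add hq' using 1
    funext t
    simp only [symbolOfFin, Pi.add_apply]
    split_ifs <;> simp
  smul_mem' := by
    rintro f q ⟨a, ha, hq⟩
    refine ⟨eulerPoly f * a, L.smul_mem _ ha, ?_⟩
    convert hq.eulerPoly_mul f using 1
    funext t
    simp only [symbolOfFin, Pi.smul_apply, smul_eq_mul]
    split_ifs <;> simp

omit [CharZero K] in
theorem symbolOfFin_eq {m : ℕ} {p : ℤ → K[X]} (h : ∀ t, p t ≠ 0 → 0 ≤ t ∧ t < m) :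
    symbolOfFin (fun i : Fin m => p i) = p := by
  funext t
  unfold symbolOfFin
  split_ifs with ht
  · simp [ht.1]
  · by_contra hne
    exact ht (h t (Ne.symm hne))

/-- Left multiplication by `f(x∂)` multiplies symbols by `f`, so the symbols in question form a
`K[X]`-submodule of a free module of finite rank; lifts of its generators span `L'`. -/
theorem exists_fg_forall_boundedSymbols (L : LeftIdeal (algebraI K 1)) (m : ℕ) :
    ∃ L' ≤ L, L'.FG ∧ ∀ q ∈ boundedSymbols L m, ∃ l ∈ L', HasSymbol l.1 (symbolOfFin q) := by
  classical
  obtain ⟨G, hG⟩ := IsNoetherian.noetherian (boundedSymbols L m)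
  have hGL : ∀ q : G, ∃ a ∈ L, HasSymbol a.1 (symbolOfFin q.1) := fun q =>
    (hG ▸ Submodule.subset_span q.2 : q.1 ∈ boundedSymbols L m)
  choose a haL ha using hGL
  refine ⟨Submodule.span _ (Set.range a), Submodule.span_le.2 ?_,
    Submodule.fg_span (Set.finite_range a), ?_⟩
  · rintro _ ⟨q, rfl⟩
    exact haL q
  · have : boundedSymbols L m ≤ boundedSymbols (Submodule.span _ (Set.range a)) m := by
      rw [← hG, Submodule.span_le]
      intro q hq
      exact ⟨a ⟨q, hq⟩, Submodule.subset_span ⟨_, rfl⟩, ha ⟨q, hq⟩⟩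
    exact fun q hq => this hq

theorem HasSymbol.sub_mem_finiteRank {a b : algebraI K 1} {p : ℤ → K[X]} (ha : HasSymbol a.1 p)
    (hb : HasSymbol b.1 p) : a - b ∈ finiteRank K := by
  rw [mem_finiteRank_iff_eventuallyZero]
  have := ha.sub hb
  rw [sub_self] at this
  exact this.eventuallyZero

/-- Every left ideal of `𝕀_1` is finitely generated modulo the ideal of operators of finite
rank. -/
theorem exists_fg_le_sup (L : LeftIdeal (algebraI K 1)) :
    ∃ L' ≤ L, L'.FG ∧ L ≤ L' ⊔ finiteRank K := by
  -- Hilbert basis argument: `l₀` realizes the generator of the ideal of leading coefficients, and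
  -- `M` covers the symbols of degree below the width `D` of the symbol of `l₀`.
  obtain ⟨g, hg⟩ := (IsPrincipalIdealRing.principal (leadingIdeal L)).principal
  obtain ⟨l₀, hl₀, p₀, hp₀, hpos, rfl⟩ : g ∈ leadingIdeal L :=
    hg ▸ Submodule.mem_span_singleton_self g
  obtain ⟨D, hD, -⟩ := id hp₀
  obtain ⟨M, hML, hMfg, hM⟩ := exists_fg_forall_boundedSymbols L D
  set L' := M ⊔ Submodule.span (algebraI K 1) {l₀} with hL'
  have hl₀' : l₀ ∈ L' := Submodule.mem_sup_right (Submodule.mem_span_singleton_self _)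
  have hL'L : L' ≤ L := sup_le hML ((Submodule.span_singleton_le_iff_mem _ _).2 hl₀)
  have key : ∀ E : ℕ, ∀ a ∈ L, ∀ p, HasSymbol a.1 p → (∀ t, p t ≠ 0 → 0 ≤ t ∧ t < E) →
      a ∈ L' ⊔ finiteRank K := by
    intro E
    induction E with
    | zero =>
      intro a _ p hp hE
      have : p = 0 := by
        funext t
        by_contra hne
        have := hE t hne
        omega
      subst this
      exact Submodule.mem_sup_right (mem_finiteRank_iff_eventuallyZero.2 hp.eventuallyZero)
    | succ E ih =>
      intro a ha p hp hE
      by_cases hED : E < D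
      · have hE' := symbolOfFin_eq (m := D) (p := p) fun t ht => by have := hE t ht; omega
        obtain ⟨l, hl, hlp⟩ := hM (fun i => p i) ⟨a, ha, by rwa [hE']⟩
        rw [hE'] at hlp
        rw [← sub_add_cancel a l]
        exact Submodule.add_mem _ (Submodule.mem_sup_right (hp.sub_mem_finiteRank hlp))
          (Submodule.mem_sup_left (Submodule.mem_sup_left hl))
      -- `∂^E` moves the top degree `E` to `0`. Subtracting `b = ∫^E f(x∂) l₀` then cancels the
      -- coefficient in degree `E`.
      · have hlead : (p E).comp (X - C ((-(E : ℤ) : ℤ) : K)) ∈ leadingIdeal L := by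
          refine ⟨_, L.smul_mem (d K 0 ^ E) ha, _, hp.d_pow_mul E, fun t ht => ?_, ?_⟩
          · have : p (t - -(E : ℤ)) = 0 := by
              by_contra hne
              have := hE _ hne
              push_cast at this
              omega
            rw [shiftSymbol, this, zero_comp]
          · simp [shiftSymbol]
        rw [hg] at hlead
        obtain ⟨f, hf⟩ := Submodule.mem_span_singleton.1 hlead
        set b : algebraI K 1 := int K 0 ^ E * (eulerPoly f * l₀) with hb
        have hbL' : b ∈ L' := L'.smul_mem _ (L'.smul_mem _ hl₀')
        have hbs := (hp₀.eulerPoly_mul f).int_pow_mul E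
        rw [← sub_add_cancel a b]
        refine Submodule.add_mem _
          (ih (a - b) (LeftIdeal.sub_mem L ha (hL'L hbL')) _ (hp.sub hbs) ?_)
          (Submodule.mem_sup_left hbL')
        intro t ht
        by_contra hcon
        apply ht
        rw [Pi.sub_apply, shiftSymbol]
        rcases lt_trichotomy t E with hlt | rfl | hgt
        · have h1 : p t = 0 := by
            by_contra hne
            have := hE _ hne
            omega
          -- Here `t < 0`, and `E ≥ D` keeps the shifted symbol of `l₀` in nonnegative degrees.
          have h2 : p₀ (t - E) = 0 := hD _ (by rw [abs_of_nonpos] <;> omega)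
          simp [h1, h2]
        · have h3 : (f * p₀ 0).comp (X - C ((E : ℤ) : K)) = p E := by
            rw [← smul_eq_mul, hf, comp_assoc]
            simp
          rw [sub_self, h3, sub_self]
        · have h1 : p t = 0 := by
            by_contra hne
            have := hE _ hne
            push_cast at this
            omega
          have h2 : p₀ (t - E) = 0 := hpos _ (by omega)
          simp [h1, h2]
  refine ⟨L', hL'L, hMfg.sup (Submodule.fg_span_singleton _), fun a ha => ?_⟩
  obtain ⟨p, hp⟩ := exists_hasSymbol a
  obtain ⟨N, hN, -⟩ := id hp
  -- `∫^N` moves a symbol supported in `(-N, N)` into `[0, 2N)`; as `∂^N ∫^N = 1`, multiplying by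
  -- `∂^N` afterwards recovers `a`.
  have := key (2 * N) _ (L.smul_mem (int K 0 ^ N) ha) _ (hp.int_pow_mul N) fun t ht => by
    have h : p (t - N) ≠ 0 := fun h => ht (by rw [shiftSymbol, h, zero_comp])
    have : |t - N| < N := by
      by_contra hlt
      exact h (hN _ (not_lt.1 hlt))
    rw [abs_lt] at this
    push_cast
    omega
  have := (L' ⊔ finiteRank K).smul_mem (d K 0 ^ N) this
  rwa [smul_eq_mul, smul_eq_mul, ← mul_assoc, d_pow_mul_int_pow, one_mul] at this

instance isNoetherian_quotient_finiteRank :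
    IsNoetherian (algebraI K 1) (algebraI K 1 ⧸ finiteRank K) :=
  isNoetherian_quotient_of_fg_sup exists_fg_le_sup

/-- Common left multiples modulo operators of finite rank. -/
theorem exists_mul_add_mul_mem_finiteRank {r : algebraI K 1} (hr : r ∉ finiteRank K)
    (s : algebraI K 1) : ∃ a b, b ∉ finiteRank K ∧ a * r + b * s ∈ finiteRank K :=
  exists_mul_add_mul_mem one_notMem_finiteRank (fun _ h r => mul_mem_finiteRank h r)
    (fun _ _ => mem_finiteRank_of_mul) hr s

end IntegroDiff

/-! ### Row operators and the coherence of `𝕀_1`. -/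

namespace IntegroDiff

variable {K : Type*} [Field K] [CharZero K]

variable (K) in
/-- The projection `1 - ∫∂` onto the constants. -/
def projZero : algebraI K 1 := 1 - int K 0 * d K 0

theorem projZero_apply (v : MvPolynomial (Fin 1) K) :
    (projZero K).1 v = (dpBasisOne K).repr v 0 • dpBasisOne K 0 := by
  have : (projZero K).1 = ((dpBasisOne K).coord 0).smulRight (dpBasisOne K 0) :=
    (dpBasisOne K).ext fun j => by
      change dpBasisOne K j - integral K 0 (partialD K 0 (dpBasisOne K j)) = _
      cases j with
      | zero => simp [partialD_dpBasisOne_zero]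
      | succ j => simp [partialD_dpBasisOne_succ, integral_dpBasisOne]
  rw [this]
  rfl

theorem repr_d_pow (k : ℕ) (v : MvPolynomial (Fin 1) K) (i : ℕ) :
    (dpBasisOne K).repr ((d K 0 ^ k).1 v) i = (dpBasisOne K).repr v (i + k) := by
  induction k generalizing v with
  | zero => rfl
  | succ k ih =>
    rw [pow_succ]
    change (dpBasisOne K).repr ((d K 0 ^ k).1 (partialD K 0 v)) i = _
    rw [ih, repr_partialD, add_assoc]

variable (K) in
/-- The operators `v ↦ ⟨u, v⟩` with values in the constants. -/
def rowOp : MvPolynomial (Fin 1) K →ₗ[K] algebraI K 1 :=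
  (dpBasisOne K).constr K fun j => projZero K * d K 0 ^ j

theorem rowOp_apply (u v : MvPolynomial (Fin 1) K) :
    (rowOp K u).1 v = dpForm K 1 u v • dpBasisOne K 0 := by
  have : ((LinearMap.applyₗ v).comp (algebraI K 1).val.toLinearMap).comp (rowOp K) =
      ((dpForm K 1).flip v).smulRight (dpBasisOne K 0) := by
    refine (dpBasisOne K).ext fun j => ?_
    change (rowOp K (dpBasisOne K j)).1 v = dpForm K 1 (dpBasisOne K j) v • dpBasisOne K 0
    rw [rowOp, Module.Basis.constr_basis, dpForm_dpBasisOne_left]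
    change (projZero K).1 ((d K 0 ^ j).1 v) = _
    rw [projZero_apply, repr_d_pow, zero_add]
  exact LinearMap.congr_fun this u

/-- This is `⟨u, c v⟩ = ⟨adj c u, v⟩`. It turns questions on left ideals of finite rank operators
into linear algebra. -/
theorem rowOp_mul (u : MvPolynomial (Fin 1) K) (c : algebraI K 1) :
    rowOp K u * c = rowOp K ((adj K c).1 u) := by
  refine Subtype.ext (LinearMap.ext fun v => ?_)
  change (rowOp K u).1 (c.1 v) = _
  rw [rowOp_apply, rowOp_apply, dpForm_adj]

theorem projZero_eq_rowOp : projZero K = rowOp K (dpBasisOne K 0) := by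
  rw [rowOp, Module.Basis.constr_basis, pow_zero, mul_one]

theorem rowOp_injective : Function.Injective (rowOp K) := by
  intro u u' h
  refine eq_of_dpForm_left K fun v => ?_
  have h' : (rowOp K u).1 v = (rowOp K u').1 v := by rw [h]
  rw [rowOp_apply, rowOp_apply] at h'
  exact smul_left_injective K ((dpBasisOne K).ne_zero 0) h'

omit [CharZero K] in
theorem one_eq_sum_add (M : ℕ) : (1 : algebraI K 1) =
    ∑ i ∈ Finset.range M, int K 0 ^ i * (projZero K * d K 0 ^ i) + int K 0 ^ M * d K 0 ^ M :=
  one_eq_sum_pow_mul_add (int K (0 : Fin 1)) (d K 0) M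

/-- Only finitely many basis vectors have nonzero image, so the range has bounded degree. -/
theorem exists_d_pow_mul_eq_zero {a : algebraI K 1} (ha : a ∈ finiteRank K) :
    ∃ M, d K 0 ^ M * a = 0 := by
  obtain ⟨N, hN⟩ := mem_finiteRank_iff_eventuallyZero.1 ha
  choose m hm using fun j => exists_mem_spanLT (a.1 (dpBasisOne K j))
  refine ⟨(Finset.range N).sup m, Subtype.ext ((dpBasisOne K).ext fun j => ?_)⟩
  change (d K 0 ^ _).1 (a.1 (dpBasisOne K j)) = 0
  refine (dpBasisOne K).repr.injective (Finsupp.ext fun i => ?_)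
  rw [repr_d_pow, map_zero, Finsupp.zero_apply]
  by_cases hj : N ≤ j
  · rw [hN j hj]
    simp
  · have : m j ≤ (Finset.range N).sup m := Finset.le_sup (by simpa using hj)
    exact mem_spanLT.1 (hm j) _ (by omega)

theorem projZero_mem_finiteRank : projZero K ∈ finiteRank K := by
  rw [mem_finiteRank_iff_eventuallyZero]
  refine ⟨1, fun j hj => ?_⟩
  rw [projZero_apply, Module.Basis.repr_self, Finsupp.single_eq_of_ne (by omega), zero_smul]

/-- `1 - ∫^M ∂^M` has finite rank. -/
theorem mem_finiteRank_of_d_pow_mul {b : algebraI K 1} {M : ℕ}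
    (h : d K 0 ^ M * b ∈ finiteRank K) : b ∈ finiteRank K := by
  rw [← one_mul b, one_eq_sum_add M, add_mul, mul_assoc (int K 0 ^ M)]
  refine Submodule.add_mem _ (mul_mem_finiteRank ?_ b) (Submodule.smul_mem _ (int K 0 ^ M) h)
  exact Submodule.sum_mem _ fun i _ => Submodule.smul_mem _ (int K 0 ^ i)
    (mul_mem_finiteRank projZero_mem_finiteRank _)

theorem adj_d_pow (M : ℕ) : adj K (d K (0 : Fin 1) ^ M) = int K 0 ^ M := by
  induction M with
  | zero => exact adj_eq K fun u v => rfl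
  | succ M ih =>
    have : adj K (d K (0 : Fin 1)) = int K 0 := adj_eq K (isAdjointPair_integral K 0)
    rw [pow_succ, adj_mul, ih, this, pow_succ']

theorem int_pow_apply (M j : ℕ) : (int K (0 : Fin 1) ^ M).1 (dpBasisOne K j) =
    dpBasisOne K (j + M) := by
  induction M with
  | zero => rfl
  | succ M ih =>
    rw [pow_succ']
    change integral K 0 ((int K (0 : Fin 1) ^ M).1 (dpBasisOne K j)) = _
    rw [ih, integral_dpBasisOne, add_assoc]

/-- Taking adjoints in `∂^M a = 0` gives `adj a ∫^M = 0`, and `∫^M` reaches every basis vector of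
degree at least `M`. -/
theorem adj_mem_finiteRank {a : algebraI K 1} (ha : a ∈ finiteRank K) :
    adj K a ∈ finiteRank K := by
  obtain ⟨M, hM⟩ := exists_d_pow_mul_eq_zero ha
  have h := adj_mul K (d K 0 ^ M) a
  rw [hM, adj_zero, adj_d_pow] at h
  rw [mem_finiteRank_iff_eventuallyZero]
  refine ⟨M, fun j hj => ?_⟩
  obtain ⟨i, rfl⟩ := Nat.exists_eq_add_of_le' hj
  rw [← int_pow_apply]
  exact (LinearMap.congr_fun (congrArg Subtype.val h) (dpBasisOne K i)).symm

theorem adj_mem_finiteRank_iff {a : algebraI K 1} :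
    adj K a ∈ finiteRank K ↔ a ∈ finiteRank K :=
  ⟨fun h => adj_adj K a ▸ adj_mem_finiteRank h, adj_mem_finiteRank⟩

/-- The vectors whose row operators lie in a left ideal. -/
def rowSpace (L : LeftIdeal (algebraI K 1)) : Submodule K (MvPolynomial (Fin 1) K) where
  carrier := {u | rowOp K u ∈ L}
  zero_mem' := by
    rw [Set.mem_ofPred_eq, map_zero]
    exact L.zero_mem
  add_mem' {u v} hu hv := by
    rw [Set.mem_ofPred_eq, map_add]
    exact L.add_mem hu hv
  smul_mem' c u hu := by
    rw [Set.mem_ofPred_eq, map_smul, Algebra.smul_def]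
    exact L.smul_mem _ hu

theorem mem_rowSpace {L : LeftIdeal (algebraI K 1)} {u : MvPolynomial (Fin 1) K} :
    u ∈ rowSpace L ↔ rowOp K u ∈ L := Iff.rfl

variable (K) in
/-- The left ideal generated by the row operators of a space of vectors. -/
def rowIdeal (W : Submodule K (MvPolynomial (Fin 1) K)) : LeftIdeal (algebraI K 1) :=
  Submodule.span (algebraI K 1) (rowOp K '' W)

theorem rowOp_mem_rowIdeal {W : Submodule K (MvPolynomial (Fin 1) K)}
    {u : MvPolynomial (Fin 1) K} (hu : u ∈ W) : rowOp K u ∈ rowIdeal K W :=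
  Submodule.subset_span ⟨u, hu, rfl⟩

theorem rowIdeal_le {W : Submodule K (MvPolynomial (Fin 1) K)} {L : LeftIdeal (algebraI K 1)} :
    rowIdeal K W ≤ L ↔ W ≤ rowSpace L := by
  rw [rowIdeal, Submodule.span_le, Set.image_subset_iff]
  rfl

theorem rowIdeal_fg (W : Submodule K (MvPolynomial (Fin 1) K)) [FiniteDimensional K W] :
    (rowIdeal K W).FG := by
  obtain ⟨T, rfl⟩ : W.FG := Module.Finite.iff_fg.1 inferInstance
  have : rowIdeal K (Submodule.span K (T : Set (MvPolynomial (Fin 1) K))) =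
      Submodule.span (algebraI K 1) (rowOp K '' T) := by
    refine le_antisymm (rowIdeal_le.2 (Submodule.span_le.2 fun u hu => ?_))
      (Submodule.span_mono (Set.image_mono Submodule.subset_span))
    exact Submodule.subset_span ⟨u, hu, rfl⟩
  rw [this]
  exact Submodule.fg_span (T.finite_toSet.image _)

/-- Since some `∂^M` kills `a`, `a` is the sum of `∫^i (1 - ∫∂) ∂^i a` over `i < M`, and each `(1 -
∫∂) ∂^i a` is a row operator in `L`. -/
theorem mem_rowIdeal_rowSpace {L : LeftIdeal (algebraI K 1)} {a : algebraI K 1} (ha : a ∈ L)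
    (haF : a ∈ finiteRank K) : a ∈ rowIdeal K (rowSpace L) := by
  obtain ⟨M, hM⟩ := exists_d_pow_mul_eq_zero haF
  rw [← one_mul a, one_eq_sum_add M, add_mul, mul_assoc (int K 0 ^ M), hM, mul_zero, add_zero,
    Finset.sum_mul]
  refine Submodule.sum_mem _ fun i _ => ?_
  rw [mul_assoc]
  refine Submodule.smul_mem _ (int K 0 ^ i) ?_
  have h : projZero K * d K 0 ^ i * a = rowOp K ((adj K (d K 0 ^ i * a)).1 (dpBasisOne K 0)) := by
    rw [mul_assoc, projZero_eq_rowOp, rowOp_mul]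
  rw [h]
  refine rowOp_mem_rowIdeal (mem_rowSpace.2 ?_)
  rw [← h]
  exact L.smul_mem _ ha

/-- A left ideal of `𝕀_1` that contains an operator of infinite rank is finitely generated. -/
theorem fg_of_not_le_finiteRank {L : LeftIdeal (algebraI K 1)} (hL : ¬ L ≤ finiteRank K) :
    L.FG := by
  obtain ⟨s, hsL, hs⟩ := SetLike.not_le_iff_exists.1 hL
  obtain ⟨L', hle, hfg, hsup⟩ := exists_fg_le_sup L
  obtain ⟨t, ht⟩ := exists_hasLead_of_notMem (mt adj_mem_finiteRank_iff.1 hs)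
  obtain ⟨m, hm⟩ := ht.exists_sup_range
  have hrange : LinearMap.range (adj K s).1 ≤ rowSpace L := by
    rintro _ ⟨u, rfl⟩
    rw [mem_rowSpace, ← rowOp_mul]
    exact L.smul_mem _ hsL
  -- `L'` generates modulo finite rank. Rows in the range of `adj s` are multiples of `s`; this
  -- range has finite codimension, so rows of degree below `m` supply the rest.
  have : L = L' ⊔ Submodule.span (algebraI K 1) {s} ⊔ rowIdeal K (rowSpace L ⊓ spanLT K m) := by
    apply le_antisymm
    · intro a ha
      obtain ⟨l, hl, f, hf, rfl⟩ := Submodule.mem_sup.1 (hsup ha)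
      have hfL : f ∈ L := L.mem_of_add_mem ha (hle hl)
      refine Submodule.add_mem _ (Submodule.mem_sup_left (Submodule.mem_sup_left hl)) ?_
      refine rowIdeal_le.2 ?_ (mem_rowIdeal_rowSpace hfL hf)
      intro u hu
      obtain ⟨w, hw, v, hv, rfl⟩ := Submodule.mem_sup.1 (hm ▸ Submodule.mem_top : u ∈ _)
      have hwL : w ∈ rowSpace L := by
        have := Submodule.sub_mem _ hu (hrange hv)
        rwa [add_sub_cancel_right] at this
      rw [mem_rowSpace, map_add]
      refine Submodule.add_mem _ (Submodule.mem_sup_right (rowOp_mem_rowIdeal ⟨hwL, hw⟩)) ?_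
      obtain ⟨z, rfl⟩ := hv
      rw [← rowOp_mul]
      exact Submodule.mem_sup_left (Submodule.mem_sup_right
        (Submodule.smul_mem _ _ (Submodule.mem_span_singleton_self s)))
    · refine sup_le (sup_le hle ?_) (rowIdeal_le.2 inf_le_left)
      rwa [Submodule.span_singleton_le_iff_mem]
  rw [this]
  have : FiniteDimensional K ↥(rowSpace L ⊓ spanLT K m) :=
    Submodule.finiteDimensional_of_le inf_le_right
  exact (hfg.sup (Submodule.fg_span_singleton s)).sup (rowIdeal_fg _)

/-- Every row lies in the sum of the ranges of the adjoints of the generators, and these adjoints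
have finite rank. -/
theorem finite_rowSpace {I : LeftIdeal (algebraI K 1)} (hI : I.FG) (hIF : I ≤ finiteRank K) :
    FiniteDimensional K (rowSpace I) := by
  obtain ⟨G, rfl⟩ := hI
  have hfin : ∀ g : G, FiniteDimensional K (LinearMap.range (adj K g.1).1) := fun g =>
    adj_mem_finiteRank (hIF (Submodule.subset_span g.2))
  have key : ∀ a ∈ Submodule.span (algebraI K 1) (G : Set (algebraI K 1)), ∀ u,
      rowOp K u * a ∈ (⨆ g : G, LinearMap.range (adj K g.1).1).map (rowOp K) := by
    intro a ha
    induction ha using Submodule.span_induction with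
    | mem g hg =>
      intro u
      rw [rowOp_mul]
      exact ⟨_, Submodule.mem_iSup_of_mem ⟨g, hg⟩ ⟨u, rfl⟩, rfl⟩
    | zero =>
      intro u
      rw [mul_zero]
      exact Submodule.zero_mem _
    | add a b _ _ iha ihb =>
      intro u
      rw [mul_add]
      exact Submodule.add_mem _ (iha u) (ihb u)
    | smul r a _ ih =>
      intro u
      rw [smul_eq_mul, ← mul_assoc, rowOp_mul]
      exact ih _
  refine Submodule.finiteDimensional_of_le (S₂ := ⨆ g : G, LinearMap.range (adj K g.1).1) ?_
  intro u hu
  -- The left factor is the projection onto the constants, so `rowOp K u` has the form treated by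
  -- `key`.
  have h : rowOp K (dpBasisOne K 0) * rowOp K u = rowOp K u := by
    refine Subtype.ext (LinearMap.ext fun v => ?_)
    change (rowOp K (dpBasisOne K 0)).1 ((rowOp K u).1 v) = _
    rw [rowOp_apply _ v, rowOp_apply, map_smul, dpForm_dpBasisOne_left]
    simp
  obtain ⟨w, hw, hwu⟩ := key _ hu (dpBasisOne K 0)
  rw [h] at hwu
  rwa [← rowOp_injective hwu]

theorem isLeftCoherentRing_algebraI_one : IsLeftCoherentRing (algebraI K 1) := by
  rw [isLeftCoherentRing_iff]
  intro I hI r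
  by_cases hL : I.comap (LinearMap.toSpanSingleton (algebraI K 1) (algebraI K 1) r) ≤ finiteRank K
  swap
  · exact fg_of_not_le_finiteRank hL
  have hmul : ∀ M b, d K 0 ^ M * b * r ∈ I → b ∈ finiteRank K := fun M b h =>
    mem_finiteRank_of_d_pow_mul (hL h)
  -- Otherwise some `∂^M` would lie in `(I : r)`, although it has infinite rank.
  have hr : r ∉ finiteRank K := by
    intro hr
    obtain ⟨M, hM⟩ := exists_d_pow_mul_eq_zero hr
    refine one_notMem_finiteRank (hmul M 1 ?_)
    rw [mul_one, hM]
    exact I.zero_mem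
  -- An `r₁ ∈ I` of infinite rank has with `r` a relation `a r₁ + b r ∈ F`, `b ∉ F`. Some `∂^M`
  -- makes it exact, so `∂^M b r ∈ I`, a contradiction.
  have hIF : I ≤ finiteRank K := by
    intro r₁ hr₁
    by_contra hr₁F
    obtain ⟨a, b, hb, hab⟩ := exists_mul_add_mul_mem_finiteRank hr₁F r
    obtain ⟨M, hM⟩ := exists_d_pow_mul_eq_zero hab
    exact hb (hmul M b (LeftIdeal.mul_mem_of_mul_add_eq_zero I hr₁ hM))
  have hle : I.comap (LinearMap.toSpanSingleton (algebraI K 1) (algebraI K 1) r) =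
      rowIdeal K (rowSpace (I.comap (LinearMap.toSpanSingleton _ _ r))) :=
    le_antisymm (fun a ha => mem_rowIdeal_rowSpace ha (hL ha)) (rowIdeal_le.2 le_rfl)
  have hcomap : rowSpace (I.comap (LinearMap.toSpanSingleton _ _ r)) =
      (rowSpace I).comap (adj K r).1 := by
    ext u
    rw [Submodule.mem_comap, mem_rowSpace, mem_rowSpace, ← rowOp_mul]
    rfl
  have : FiniteDimensional K (rowSpace I) := finite_rowSpace hI hIF
  obtain ⟨t, ht⟩ := exists_hasLead_of_notMem (mt adj_mem_finiteRank_iff.1 hr)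
  have := ht.finite_ker
  -- `adj r` is not of finite rank, so its kernel is finite-dimensional; preimages of
  -- finite-dimensional spaces stay so.
  have : FiniteDimensional K ((rowSpace I).comap (adj K r).1) := by
    refine Module.Finite.iff_fg.2 (Submodule.fg_of_fg_map_of_fg_inf_ker (adj K r).1 ?_ ?_)
    · have := Submodule.finiteDimensional_of_le (Submodule.map_comap_le (adj K r).1 (rowSpace I))
      exact Module.Finite.iff_fg.1 this
    · have := Submodule.finiteDimensional_of_le
        (inf_le_right : (rowSpace I).comap (adj K r).1 ⊓ LinearMap.ker (adj K r).1 ≤ _)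
      exact Module.Finite.iff_fg.1 this
  rw [hle, hcomap]
  exact rowIdeal_fg _

end IntegroDiff

/-! ### The isomorphism `𝕀_k ⊗ 𝕀_m ≃ 𝕀_{k+m}`. -/

namespace IntegroDiff

variable {K : Type*} [Field K] [CharZero K] {k m : ℕ}

/-- Concatenation of multi-indices. -/
def appendIdx (k m : ℕ) : (Fin k →₀ ℕ) × (Fin m →₀ ℕ) ≃ (Fin (k + m) →₀ ℕ) :=
  ((Finsupp.equivFunOnFinite.prodCongr Finsupp.equivFunOnFinite).trans
    (Fin.appendEquiv k m)).trans Finsupp.equivFunOnFinite.symm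

theorem appendIdx_castAdd (s : Fin k →₀ ℕ) (t : Fin m →₀ ℕ) (i : Fin k) :
    appendIdx k m (s, t) (Fin.castAdd m i) = s i := by
  simp [appendIdx, Fin.appendEquiv]

theorem appendIdx_natAdd (s : Fin k →₀ ℕ) (t : Fin m →₀ ℕ) (j : Fin m) :
    appendIdx k m (s, t) (Fin.natAdd k j) = t j := by
  simp [appendIdx, Fin.appendEquiv]

theorem appendIdx_add_single_left (s : Fin k →₀ ℕ) (t : Fin m →₀ ℕ) (i : Fin k) :
    appendIdx k m (s + Finsupp.single i 1, t) =
      appendIdx k m (s, t) + Finsupp.single (Fin.castAdd m i) 1 := by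
  ext j
  refine Fin.addCases (fun j => ?_) (fun j => ?_) j
  · simp [appendIdx_castAdd, Finsupp.single_apply]
  · have : Fin.castAdd m i ≠ Fin.natAdd k j := by
      simp [Fin.ext_iff]
      omega
    simp [appendIdx_natAdd, this]

theorem appendIdx_add_single_right (s : Fin k →₀ ℕ) (t : Fin m →₀ ℕ) (i : Fin m) :
    appendIdx k m (s, t + Finsupp.single i 1) =
      appendIdx k m (s, t) + Finsupp.single (Fin.natAdd k i) 1 := by
  ext j
  refine Fin.addCases (fun j => ?_) (fun j => ?_) j
  · have : Fin.natAdd k i ≠ Fin.castAdd m j := by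
      simp [Fin.ext_iff]
      omega
    simp [appendIdx_castAdd, this]
  · simp [appendIdx_natAdd, Finsupp.single_apply]

variable (K k m) in
/-- `P_k ⊗ P_m ≃ P_{k+m}`. -/
def polyTensorEquiv : MvPolynomial (Fin k) K ⊗[K] MvPolynomial (Fin m) K ≃ₗ[K]
    MvPolynomial (Fin (k + m)) K :=
  ((dpBasis K k).tensorProduct (dpBasis K m)).equiv (dpBasis K (k + m)) (appendIdx k m)

theorem polyTensorEquiv_basis (s : Fin k →₀ ℕ) (t : Fin m →₀ ℕ) :
    polyTensorEquiv K k m (dpBasis K k s ⊗ₜ dpBasis K m t) =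
      dpBasis K (k + m) (appendIdx k m (s, t)) := by
  rw [polyTensorEquiv, ← Module.Basis.tensorProduct_apply, Module.Basis.equiv_apply]

variable (K k m) in
/-- The action of `End(P_k) ⊗ End(P_m)` on `P_{k+m}`. -/
def endTensorHom : Module.End K (MvPolynomial (Fin k) K) ⊗[K]
    Module.End K (MvPolynomial (Fin m) K) →ₐ[K] Module.End K (MvPolynomial (Fin (k + m)) K) :=
  ((polyTensorEquiv K k m).conjAlgEquiv K).toAlgHom.comp
    (Module.endTensorEndAlgHom (R := K) (S := K) (A := K))

theorem endTensorHom_tmul (a : Module.End K (MvPolynomial (Fin k) K))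
    (b : Module.End K (MvPolynomial (Fin m) K)) (s : Fin k →₀ ℕ) (t : Fin m →₀ ℕ) :
    endTensorHom K k m (a ⊗ₜ b) (dpBasis K (k + m) (appendIdx k m (s, t))) =
      polyTensorEquiv K k m (a (dpBasis K k s) ⊗ₜ b (dpBasis K m t)) := by
  rw [← polyTensorEquiv_basis]
  simp [endTensorHom, LinearEquiv.conjAlgEquiv_apply]
  rfl

theorem endTensorHom_ext {f g : Module.End K (MvPolynomial (Fin (k + m)) K)}
    (h : ∀ s t, f (dpBasis K (k + m) (appendIdx k m (s, t))) =
      g (dpBasis K (k + m) (appendIdx k m (s, t)))) : f = g := by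
  refine (dpBasis K (k + m)).ext fun u => ?_
  obtain ⟨⟨s, t⟩, rfl⟩ := (appendIdx k m).surjective u
  exact h s t

theorem endTensorHom_mulX_left (i : Fin k) :
    endTensorHom K k m (mulX K i ⊗ₜ 1) = mulX K (Fin.castAdd m i) := by
  refine endTensorHom_ext fun s t => ?_
  rw [endTensorHom_tmul, mulX_dpBasis, mulX_dpBasis, ← TensorProduct.smul_tmul', map_smul,
    Module.End.one_apply, polyTensorEquiv_basis, appendIdx_add_single_left, appendIdx_castAdd]

theorem endTensorHom_mulX_right (i : Fin m) :
    endTensorHom K k m (1 ⊗ₜ mulX K i) = mulX K (Fin.natAdd k i) := by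
  refine endTensorHom_ext fun s t => ?_
  rw [endTensorHom_tmul, mulX_dpBasis, mulX_dpBasis, TensorProduct.tmul_smul, map_smul,
    Module.End.one_apply, polyTensorEquiv_basis, appendIdx_add_single_right, appendIdx_natAdd]

theorem endTensorHom_integral_left (i : Fin k) :
    endTensorHom K k m (integral K i ⊗ₜ 1) = integral K (Fin.castAdd m i) := by
  refine endTensorHom_ext fun s t => ?_
  rw [endTensorHom_tmul, integral_dpBasis, integral_dpBasis,
    Module.End.one_apply, polyTensorEquiv_basis, appendIdx_add_single_left]

theorem endTensorHom_integral_right (i : Fin m) :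
    endTensorHom K k m (1 ⊗ₜ integral K i) = integral K (Fin.natAdd k i) := by
  refine endTensorHom_ext fun s t => ?_
  rw [endTensorHom_tmul, integral_dpBasis, integral_dpBasis,
    Module.End.one_apply, polyTensorEquiv_basis, appendIdx_add_single_right]

theorem endTensorHom_partialD_left (i : Fin k) :
    endTensorHom K k m (partialD K i ⊗ₜ 1) = partialD K (Fin.castAdd m i) := by
  refine endTensorHom_ext fun s t => ?_
  rw [endTensorHom_tmul]
  by_cases h : s i = 0
  · rw [partialD_dpBasis_of_eq_zero K i s h, partialD_dpBasis_of_eq_zero _ _ _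
      (by rwa [appendIdx_castAdd]), TensorProduct.zero_tmul, map_zero]
  · obtain ⟨s, rfl⟩ := exists_eq_add_single i s h
    rw [appendIdx_add_single_left, partialD_dpBasis_add, partialD_dpBasis_add,
      Module.End.one_apply, polyTensorEquiv_basis]

theorem endTensorHom_partialD_right (i : Fin m) :
    endTensorHom K k m (1 ⊗ₜ partialD K i) = partialD K (Fin.natAdd k i) := by
  refine endTensorHom_ext fun s t => ?_
  rw [endTensorHom_tmul]
  by_cases h : t i = 0
  · rw [partialD_dpBasis_of_eq_zero K i t h, partialD_dpBasis_of_eq_zero _ _ _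
      (by rwa [appendIdx_natAdd]), TensorProduct.tmul_zero, map_zero]
  · obtain ⟨t, rfl⟩ := exists_eq_add_single i t h
    rw [appendIdx_add_single_right, partialD_dpBasis_add, partialD_dpBasis_add,
      Module.End.one_apply, polyTensorEquiv_basis]

variable (K k m) in
/-- The action of `𝕀_k ⊗ 𝕀_m` on `P_{k+m}`. -/
def algebraITensorHom : algebraI K k ⊗[K] algebraI K m →ₐ[K]
    Module.End K (MvPolynomial (Fin (k + m)) K) :=
  (endTensorHom K k m).comp (Algebra.TensorProduct.map (algebraI K k).val (algebraI K m).val)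

theorem algebraITensorHom_tmul (a : algebraI K k) (b : algebraI K m) :
    algebraITensorHom K k m (a ⊗ₜ b) = endTensorHom K k m (a.1 ⊗ₜ b.1) := rfl

theorem endTensorHom_left_mem {a : Module.End K (MvPolynomial (Fin k) K)} (ha : a ∈ algebraI K k) :
    endTensorHom K k m (a ⊗ₜ 1) ∈ algebraI K (k + m) := by
  have : algebraI K k ≤ (algebraI K (k + m)).comap
      ((endTensorHom K k m).comp Algebra.TensorProduct.includeLeft) := by
    refine Algebra.adjoin_le ?_
    rintro _ ((⟨i, rfl⟩ | ⟨i, rfl⟩) | ⟨i, rfl⟩)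
    · change endTensorHom K k m (mulX K i ⊗ₜ 1) ∈ algebraI K (k + m)
      rw [endTensorHom_mulX_left]
      exact mulX_mem K _
    · change endTensorHom K k m (partialD K i ⊗ₜ 1) ∈ algebraI K (k + m)
      rw [endTensorHom_partialD_left]
      exact partialD_mem K _
    · change endTensorHom K k m (integral K i ⊗ₜ 1) ∈ algebraI K (k + m)
      rw [endTensorHom_integral_left]
      exact integral_mem K _
  exact this ha

theorem endTensorHom_right_mem {b : Module.End K (MvPolynomial (Fin m) K)} (hb : b ∈ algebraI K m) :
    endTensorHom K k m (1 ⊗ₜ b) ∈ algebraI K (k + m) := by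
  have : algebraI K m ≤ (algebraI K (k + m)).comap
      ((endTensorHom K k m).comp Algebra.TensorProduct.includeRight) := by
    refine Algebra.adjoin_le ?_
    rintro _ ((⟨i, rfl⟩ | ⟨i, rfl⟩) | ⟨i, rfl⟩)
    · change endTensorHom K k m (1 ⊗ₜ mulX K i) ∈ algebraI K (k + m)
      rw [endTensorHom_mulX_right]
      exact mulX_mem K _
    · change endTensorHom K k m (1 ⊗ₜ partialD K i) ∈ algebraI K (k + m)
      rw [endTensorHom_partialD_right]
      exact partialD_mem K _
    · change endTensorHom K k m (1 ⊗ₜ integral K i) ∈ algebraI K (k + m)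
      rw [endTensorHom_integral_right]
      exact integral_mem K _
  exact this hb

theorem algebraITensorHom_mem (z : algebraI K k ⊗[K] algebraI K m) :
    algebraITensorHom K k m z ∈ algebraI K (k + m) := by
  induction z with
  | zero => rw [map_zero]; exact zero_mem _
  | add z w hz hw => rw [map_add]; exact add_mem hz hw
  | tmul a b =>
    have : endTensorHom K k m (a.1 ⊗ₜ b.1) =
        endTensorHom K k m (a.1 ⊗ₜ 1) * endTensorHom K k m (1 ⊗ₜ b.1) := by
      rw [← map_mul, Algebra.TensorProduct.tmul_mul_tmul, mul_one, one_mul]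
    rw [algebraITensorHom_tmul, this]
    exact mul_mem (endTensorHom_left_mem a.2) (endTensorHom_right_mem b.2)

theorem range_algebraITensorHom : (algebraITensorHom K k m).range = algebraI K (k + m) := by
  apply le_antisymm
  · rintro _ ⟨z, rfl⟩
    exact algebraITensorHom_mem z
  · refine Algebra.adjoin_le ?_
    rintro _ ((⟨i, rfl⟩ | ⟨i, rfl⟩) | ⟨i, rfl⟩) <;>
      refine Fin.addCases (fun i => ?_) (fun i => ?_) i
    · exact ⟨x K i ⊗ₜ 1, endTensorHom_mulX_left i⟩
    · exact ⟨1 ⊗ₜ x K i, endTensorHom_mulX_right i⟩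
    · exact ⟨d K i ⊗ₜ 1, endTensorHom_partialD_left i⟩
    · exact ⟨1 ⊗ₜ d K i, endTensorHom_partialD_right i⟩
    · exact ⟨int K i ⊗ₜ 1, endTensorHom_integral_left i⟩
    · exact ⟨1 ⊗ₜ int K i, endTensorHom_integral_right i⟩

variable (m) in
/-- Evaluation at `p` in the first tensor factor. -/
def evalLeft (p : MvPolynomial (Fin k) K) :
    algebraI K k ⊗[K] algebraI K m →ₗ[K] MvPolynomial (Fin k) K ⊗[K] algebraI K m :=
  LinearMap.rTensor _ ((LinearMap.applyₗ p).comp (algebraI K k).val.toLinearMap)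

omit [CharZero K] in
theorem evalLeft_tmul (p : MvPolynomial (Fin k) K) (a : algebraI K k) (b : algebraI K m) :
    evalLeft m p (a ⊗ₜ b) = a.1 p ⊗ₜ b := rfl

omit [CharZero K] in
theorem equivFinsupp_evalLeft {ι : Type*} [DecidableEq ι] (C : Module.Basis ι K (algebraI K m))
    (p : MvPolynomial (Fin k) K) (z : algebraI K k ⊗[K] algebraI K m) (i : ι) :
    TensorProduct.equivFinsuppOfBasisRight C (evalLeft m p z) i =
      (TensorProduct.equivFinsuppOfBasisRight C z i).1 p := by
  induction z with
  | zero => simp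
  | add z w hz hw => simp only [map_add, Finsupp.add_apply, hz, hw]; rfl
  | tmul a b =>
    rw [evalLeft_tmul, TensorProduct.equivFinsuppOfBasisRight_apply_tmul_apply,
      TensorProduct.equivFinsuppOfBasisRight_apply_tmul_apply]
    rfl

/-- In a basis of `𝕀_m`, the coordinates of `z` are operators in `𝕀_k`, hence determined by their
values. -/
theorem eq_of_evalLeft {z w : algebraI K k ⊗[K] algebraI K m}
    (h : ∀ s, evalLeft m (dpBasis K k s) z = evalLeft m (dpBasis K k s) w) : z = w := by
  classical
  let C := Module.Basis.ofVectorSpace K (algebraI K m)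
  refine (TensorProduct.equivFinsuppOfBasisRight C).injective (Finsupp.ext fun i => ?_)
  refine Subtype.ext ((dpBasis K k).ext fun s => ?_)
  rw [← equivFinsupp_evalLeft, h, equivFinsupp_evalLeft]

theorem algebraITensorHom_apply (z : algebraI K k ⊗[K] algebraI K m) (s : Fin k →₀ ℕ)
    (t : Fin m →₀ ℕ) :
    algebraITensorHom K k m z (dpBasis K (k + m) (appendIdx k m (s, t))) =
      polyTensorEquiv K k m (LinearMap.lTensor _
        ((LinearMap.applyₗ (dpBasis K m t)).comp (algebraI K m).val.toLinearMap)
        (evalLeft m (dpBasis K k s) z)) := by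
  induction z with
  | zero => simp
  | add z w hz hw => simp only [map_add, LinearMap.add_apply, hz, hw]
  | tmul a b => rw [algebraITensorHom_tmul, endTensorHom_tmul, evalLeft_tmul]; rfl

/-- Evaluate the first factor, then the second: coordinates in a basis of `P_k` are operators in
`𝕀_m`, again determined by their values. -/
theorem algebraITensorHom_injective : Function.Injective (algebraITensorHom K k m) := by
  classical
  intro z z' hz
  refine eq_of_evalLeft fun s => ?_
  let B := dpBasis K k
  have key : ∀ (q : MvPolynomial (Fin m) K) (w : MvPolynomial (Fin k) K ⊗[K] algebraI K m) i,
      TensorProduct.equivFinsuppOfBasisLeft B (LinearMap.lTensor _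
        ((LinearMap.applyₗ q).comp (algebraI K m).val.toLinearMap) w) i =
        (TensorProduct.equivFinsuppOfBasisLeft B w i).1 q := by
    intro q w i
    induction w with
    | zero => simp
    | add z w hz hw => simp only [map_add, Finsupp.add_apply, hz, hw]; rfl
    | tmul a b =>
      rw [LinearMap.lTensor_tmul, TensorProduct.equivFinsuppOfBasisLeft_apply_tmul_apply,
        TensorProduct.equivFinsuppOfBasisLeft_apply_tmul_apply]
      rfl
  refine (TensorProduct.equivFinsuppOfBasisLeft B).injective (Finsupp.ext fun i => ?_)
  refine Subtype.ext ((dpBasis K m).ext fun t => ?_)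
  have h := algebraITensorHom_apply z s t
  rw [hz, algebraITensorHom_apply z' s t] at h
  rw [← key, ← (polyTensorEquiv K k m).injective h, key]

variable (K k m) in
/-- The canonical isomorphism `𝕀_k ⊗ 𝕀_m ≃ 𝕀_{k+m}`. -/
def tensorIso : (algebraI K k ⊗[K] algebraI K m) ≃ₐ[K] algebraI K (k + m) :=
  (AlgEquiv.ofInjective (algebraITensorHom K k m) algebraITensorHom_injective).trans
    (Subalgebra.equivOfEq _ _ range_algebraITensorHom)

theorem coe_tensorIso (z : algebraI K k ⊗[K] algebraI K m) :
    (tensorIso K k m z).1 = algebraITensorHom K k m z := rfl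

theorem isCanonicalIso_tensorIso : IsCanonicalIso K (tensorIso K k m) :=
  ⟨fun i => ⟨Subtype.ext (endTensorHom_mulX_left i), Subtype.ext (endTensorHom_partialD_left i),
      Subtype.ext (endTensorHom_integral_left i)⟩,
    fun i => ⟨Subtype.ext (endTensorHom_mulX_right i), Subtype.ext (endTensorHom_partialD_right i),
      Subtype.ext (endTensorHom_integral_right i)⟩⟩

end IntegroDiff

/-! ### Rank one operators and the kernel of `H_1 - H_2`. -/

namespace IntegroDiff

variable {K : Type*} [Field K] [CharZero K] {n m : ℕ}

omit [CharZero K] in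
theorem mulLeft_mem (p : MvPolynomial (Fin n) K) : LinearMap.mulLeft K p ∈ algebraI K n := by
  induction p using MvPolynomial.induction_on with
  | C a =>
    convert algebraMap_mem (algebraI K n) a
    refine LinearMap.ext fun q => ?_
    rw [LinearMap.mulLeft_apply, Module.algebraMap_end_apply, MvPolynomial.C_mul']
  | add p q hp hq =>
    have : LinearMap.mulLeft K (p + q) = LinearMap.mulLeft K p + LinearMap.mulLeft K q :=
      LinearMap.ext fun r => add_mul p q r
    rw [this]
    exact add_mem hp hq
  | mul_X p i hp =>
    rw [LinearMap.mulLeft_mul]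
    exact mul_mem hp (mulX_mem K i)

theorem exists_proj_mem (S : Finset (Fin n)) : ∃ a ∈ algebraI K n, ∀ s,
    a (dpBasis K n s) = if ∀ i ∈ S, s i = 0 then dpBasis K n s else 0 := by
  classical
  induction S using Finset.induction with
  | empty => exact ⟨1, one_mem _, by simp⟩
  | insert i S _ ih =>
    obtain ⟨a, ha, h⟩ := ih
    -- `1 - ∫_i ∂_i` keeps the monomials free of `x_i` and kills the others.
    refine ⟨(1 - integral K i * partialD K i) * a, mul_mem (sub_mem (one_mem _)
      (mul_mem (integral_mem K i) (partialD_mem K i))) ha, fun s => ?_⟩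
    rw [Module.End.mul_apply, h]
    by_cases hS : ∀ j ∈ S, s j = 0
    · rw [if_pos hS, LinearMap.sub_apply, Module.End.one_apply, Module.End.mul_apply]
      by_cases hi : s i = 0
      · rw [partialD_dpBasis_of_eq_zero K i s hi, map_zero, sub_zero, if_pos]
        exact fun j hj => (Finset.mem_insert.1 hj).elim (fun h => h ▸ hi) (hS j)
      · rw [if_neg fun h => hi (h i (Finset.mem_insert_self i S))]
        obtain ⟨s, rfl⟩ := exists_eq_add_single i s hi
        rw [partialD_dpBasis_add, integral_dpBasis, sub_self]
    · rw [if_neg hS, map_zero, if_neg fun h => hS fun j hj => h j (Finset.mem_insert_of_mem hj)]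

/-- Start from the projection onto the constants; composing with `∂_i` on the right raises the index
`s` in direction `i`. -/
theorem coord_smulRight_one_mem (s : Fin n →₀ ℕ) :
    ((dpBasis K n).coord s).smulRight (dpBasis K n 0) ∈ algebraI K n := by
  classical
  have hstep : ∀ (i : Fin n) (s : Fin n →₀ ℕ),
      ((dpBasis K n).coord s).smulRight (dpBasis K n 0) ∈ algebraI K n →
      ((dpBasis K n).coord (s + Finsupp.single i 1)).smulRight (dpBasis K n 0) ∈
        algebraI K n := by
    intro i s hs
    convert mul_mem hs (partialD_mem K i)
    refine (dpBasis K n).ext fun t => ?_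
    rw [Module.End.mul_apply, LinearMap.smulRight_apply, LinearMap.smulRight_apply]
    by_cases ht : t i = 0
    · have : t ≠ s + Finsupp.single i 1 := by
        rintro rfl
        simp at ht
      rw [partialD_dpBasis_of_eq_zero K i t ht]
      simp [this]
    · obtain ⟨t, rfl⟩ := exists_eq_add_single i t ht
      rw [partialD_dpBasis_add]
      simp [Finsupp.single_apply]
  have hpow : ∀ (i : Fin n) (k : ℕ) (s : Fin n →₀ ℕ),
      ((dpBasis K n).coord s).smulRight (dpBasis K n 0) ∈ algebraI K n →
      ((dpBasis K n).coord (Finsupp.single i k + s)).smulRight (dpBasis K n 0) ∈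
        algebraI K n := by
    intro i k s hs
    induction k with
    | zero => simpa using hs
    | succ k ih =>
      rw [Finsupp.single_add, add_right_comm]
      exact hstep i _ ih
  induction s using Finsupp.induction with
  | zero =>
    obtain ⟨a, ha, h⟩ := exists_proj_mem (K := K) (Finset.univ : Finset (Fin n))
    convert ha
    refine (dpBasis K n).ext fun t => ?_
    rw [h, LinearMap.smulRight_apply]
    by_cases ht : t = 0
    · subst ht
      simp
    · rw [if_neg fun h => ht (Finsupp.ext fun i => h i (Finset.mem_univ i))]
      simp [ht]
  | single_add i k s _ _ ih => exact hpow i k s ih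

theorem coord_smulRight_mem (s : Fin n →₀ ℕ) (p : MvPolynomial (Fin n) K) :
    ((dpBasis K n).coord s).smulRight p ∈ algebraI K n := by
  have h0 : dpBasis K n 0 = 1 := by
    rw [dpBasis_apply]
    simp [invFactorial]
  have : ((dpBasis K n).coord s).smulRight p =
      LinearMap.mulLeft K p * ((dpBasis K n).coord s).smulRight (dpBasis K n 0) := by
    refine LinearMap.ext fun q => ?_
    rw [h0, Module.End.mul_apply, LinearMap.smulRight_apply, LinearMap.smulRight_apply,
      LinearMap.mulLeft_apply, mul_smul_comm, mul_one]
  rw [this]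
  exact mul_mem (mulLeft_mem p) (coord_smulRight_one_mem s)

/-- The rank one operator that sends `x^s / s!` to `p` and the other monomials to zero. -/
def rankOne (s : Fin n →₀ ℕ) : MvPolynomial (Fin n) K →ₗ[K] algebraI K n where
  toFun p := ⟨((dpBasis K n).coord s).smulRight p, coord_smulRight_mem s p⟩
  map_add' p q := Subtype.ext (LinearMap.ext fun _ => smul_add _ p q)
  map_smul' c p := Subtype.ext (LinearMap.ext fun _ => smul_comm _ c p)

theorem rankOne_apply_self (s : Fin n →₀ ℕ) (p : MvPolynomial (Fin n) K) :
    (rankOne s p).1 (dpBasis K n s) = p := by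
  change (dpBasis K n).repr (dpBasis K n s) s • p = p
  simp

theorem rankOne_apply_of_ne {s t : Fin n →₀ ℕ} (h : t ≠ s) (p : MvPolynomial (Fin n) K) :
    (rankOne s p).1 (dpBasis K n t) = 0 := by
  change (dpBasis K n).repr (dpBasis K n t) s • p = 0
  simp [h]

/-- For fixed `s`, the rank one operators thus form a left ideal isomorphic to `P_n`. -/
theorem mul_rankOne (a : algebraI K n) (s : Fin n →₀ ℕ) (p : MvPolynomial (Fin n) K) :
    a * rankOne s p = rankOne s (a.1 p) :=
  Subtype.ext (LinearMap.ext fun v => map_smul a.1 ((dpBasis K n).repr v s) p)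

omit [CharZero K] in
theorem evalLeft_mul_tmul_one (p : MvPolynomial (Fin n) K)
    (z : algebraI K n ⊗[K] algebraI K m) (c : algebraI K n) :
    evalLeft m p (z * (c ⊗ₜ 1)) = evalLeft m (c.1 p) z := by
  induction z with
  | zero => rw [zero_mul, map_zero, map_zero]
  | add z w hz hw => rw [add_mul, map_add, map_add, hz, hw]
  | tmul a b =>
    rw [Algebra.TensorProduct.tmul_mul_tmul, mul_one, evalLeft_tmul, evalLeft_tmul]
    rfl

omit [CharZero K] in
theorem evalLeft_mul_eq_zero {p : MvPolynomial (Fin n) K}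
    {w : algebraI K n ⊗[K] algebraI K m} (hw : evalLeft m p w = 0)
    (z : algebraI K n ⊗[K] algebraI K m) : evalLeft m p (z * w) = 0 := by
  induction z with
  | zero => rw [zero_mul, map_zero]
  | add z z' hz hz' => rw [add_mul, map_add, hz, hz', add_zero]
  | tmul a b =>
    have : evalLeft m p ((a ⊗ₜ b) * w) =
        TensorProduct.map a.1 (LinearMap.mulLeft K b) (evalLeft m p w) := by
      clear hw
      induction w with
      | zero => rw [mul_zero, map_zero, map_zero]
      | add w w' hw hw' => rw [mul_add, map_add, map_add, map_add, hw, hw']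
      | tmul c d =>
        rw [Algebra.TensorProduct.tmul_mul_tmul, evalLeft_tmul, evalLeft_tmul]
        rfl
    rw [this, hw, map_zero]

theorem H_apply (i : Fin n) (s : Fin n →₀ ℕ) :
    (H K i).1 (dpBasis K n s) = (s i + 1 : K) • dpBasis K n s := by
  change partialD K i (mulX K i (dpBasis K n s)) = _
  rw [mulX_dpBasis, map_smul, partialD_dpBasis_add]

theorem tensorIso_H {k : ℕ} (i : Fin k) :
    tensorIso K k m (H K i ⊗ₜ 1) = H K (Fin.castAdd m i) := by
  have h := (isCanonicalIso_tensorIso (K := K) (k := k) (m := m)).1 i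
  have : (H K i ⊗ₜ 1 : algebraI K k ⊗[K] algebraI K m) = (d K i ⊗ₜ 1) * (x K i ⊗ₜ 1) := by
    rw [Algebra.TensorProduct.tmul_mul_tmul, mul_one]
    rfl
  rw [this, map_mul, h.1, h.2.1]
  rfl

theorem mem_kerMulRight_sub {R : Type*} [Ring R] {a r s : R} :
    a ∈ kerMulRight (r - s) ↔ a * r = a * s := by
  rw [mem_kerMulRight, mul_sub, sub_eq_zero]

/-- `H_1 - H_2` is diagonal with eigenvalue `s 0 - s 1`, which in characteristic zero vanishes on
the diagonal only. -/
theorem tensorIso_mem_kerMulRight_iff (z : algebraI K 2 ⊗[K] algebraI K m) :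
    tensorIso K 2 m z ∈ kerMulRight
        (H K (Fin.castAdd m (0 : Fin 2)) - H K (Fin.castAdd m (1 : Fin 2))) ↔
      ∀ s : Fin 2 →₀ ℕ, s 0 ≠ s 1 → evalLeft m (dpBasis K 2 s) z = 0 := by
  rw [mem_kerMulRight_sub, ← tensorIso_H, ← tensorIso_H, ← map_mul, ← map_mul,
    (tensorIso K 2 m).injective.eq_iff]
  have hev : ∀ (s : Fin 2 →₀ ℕ) (i : Fin 2), evalLeft m (dpBasis K 2 s) (z * (H K i ⊗ₜ 1)) =
      (s i + 1 : K) • evalLeft m (dpBasis K 2 s) z := by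
    intro s i
    rw [evalLeft_mul_tmul_one, H_apply]
    simp [evalLeft, LinearMap.rTensor_smul, LinearMap.smul_comp]
  constructor
  · intro h s hs
    have h' := hev s 0
    rw [h, hev s 1] at h'
    by_contra hne
    have := smul_left_injective K hne h'
    rw [add_left_inj, Nat.cast_inj] at this
    exact hs this.symm
  · intro h
    refine eq_of_evalLeft fun s => ?_
    rw [hev, hev]
    by_cases hs : s 0 = s 1
    · rw [hs]
    · rw [h s hs, smul_zero, smul_zero]

end IntegroDiff

/-! ### Vanishing along the diagonal and the infinite direct sum. -/

namespace IntegroDiff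

variable {K : Type*} [Field K] [CharZero K] {n m : ℕ}

theorem repr_polyTensorEquiv {k m : ℕ} (w : MvPolynomial (Fin k) K ⊗[K] MvPolynomial (Fin m) K)
    (u : (Fin k →₀ ℕ) × (Fin m →₀ ℕ)) :
    (dpBasis K (k + m)).repr (polyTensorEquiv K k m w) (appendIdx k m u) =
      ((dpBasis K k).tensorProduct (dpBasis K m)).repr w u := by
  have : polyTensorEquiv K k m w = Finsupp.linearCombination K (dpBasis K (k + m) ∘ appendIdx k m)
      (((dpBasis K k).tensorProduct (dpBasis K m)).repr w) := by
    simp [polyTensorEquiv, Module.Basis.equiv]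
  rw [this, ← Finsupp.linearCombination_mapDomain, Module.Basis.repr_linearCombination,
    Finsupp.mapDomain_apply (appendIdx k m).injective]

/-- The pair `(i, j)` as a multi-index in two variables. -/
def pairIdx (i j : ℕ) : Fin (1 + 1) →₀ ℕ :=
  appendIdx 1 1 (Finsupp.single 0 i, Finsupp.single 0 j)

theorem pairIdx_zero (i j : ℕ) : pairIdx i j 0 = i := by
  refine (appendIdx_castAdd (Finsupp.single 0 i) (Finsupp.single 0 j) 0).trans ?_
  rw [Finsupp.single_eq_same]

theorem pairIdx_one (i j : ℕ) : pairIdx i j 1 = j := by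
  refine (appendIdx_natAdd (Finsupp.single 0 i) (Finsupp.single 0 j) 0).trans ?_
  rw [Finsupp.single_eq_same]

theorem eq_pairIdx (s : Fin (1 + 1) →₀ ℕ) : s = pairIdx (s 0) (s 1) := by
  ext i
  fin_cases i
  · exact (pairIdx_zero _ _).symm
  · exact (pairIdx_one _ _).symm

open Polynomial in
/-- For large `j₁` the coefficients of an operator in two variables depend polynomially on the
first index. -/
theorem exists_polynomial_coeff (z : algebraI K 1 ⊗[K] algebraI K 1) :
    ∃ N : ℕ, ∀ (j₂ i₂ : ℕ) (t : ℤ), ∃ f : K[X], ∀ j₁ ≥ N, ∀ i₁ : ℕ, (i₁ : ℤ) = j₁ + t →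
      (dpBasis K (1 + 1)).repr (algebraITensorHom K 1 1 z (dpBasis K (1 + 1) (pairIdx j₁ j₂)))
        (pairIdx i₁ i₂) = f.eval (i₁ : K) := by
  induction z with
  | zero => exact ⟨0, fun _ _ _ => ⟨0, by simp⟩⟩
  | add z w hz hw =>
    obtain ⟨N, hN⟩ := hz
    obtain ⟨M, hM⟩ := hw
    refine ⟨max N M, fun j₂ i₂ t => ?_⟩
    obtain ⟨f, hf⟩ := hN j₂ i₂ t
    obtain ⟨g, hg⟩ := hM j₂ i₂ t
    refine ⟨f + g, fun j₁ hj i₁ hi => ?_⟩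
    rw [map_add, LinearMap.add_apply, map_add, Finsupp.add_apply,
      hf j₁ ((le_max_left _ _).trans hj) i₁ hi, hg j₁ ((le_max_right _ _).trans hj) i₁ hi, eval_add]
  | tmul a b =>
    obtain ⟨p, N, -, hp⟩ := exists_hasSymbol a
    -- `N` comes from the symbol of `a` alone, so it is uniform in `j₂`, `i₂` and `t`; `b`
    -- contributes only a scalar.
    refine ⟨N, fun j₂ i₂ t => ⟨C ((dpBasis K 1).repr (b.1 (dpBasis K 1 (Finsupp.single 0 j₂)))
      (Finsupp.single 0 i₂)) * p t, fun j₁ hj i₁ hi => ?_⟩⟩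
    rw [pairIdx, pairIdx, algebraITensorHom_tmul, endTensorHom_tmul, repr_polyTensorEquiv,
      Module.Basis.tensorProduct_repr_tmul_apply]
    have h := hp j₁ hj i₁
    rw [dpBasisOne_apply, ← dpForm_dpBasisOne_left, dpBasisOne_apply, dpForm_basis_left, hi,
      add_sub_cancel_left] at h
    rw [h, eval_mul, eval_C]
    simp [mul_comm]

/-- An operator in two variables that annihilates all `x₁^i x₂^j` with `i ≠ j` annihilates
`x₁^k x₂^k` for all large `k`. -/
theorem eventually_apply_diag_eq_zero (a : algebraI K (1 + 1))
    (h : ∀ i j, i ≠ j → a.1 (dpBasis K (1 + 1) (pairIdx i j)) = 0) :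
    ∃ N, ∀ k ≥ N, a.1 (dpBasis K (1 + 1) (pairIdx k k)) = 0 := by
  obtain ⟨z, rfl⟩ := (tensorIso K 1 1).surjective a
  obtain ⟨N, hN⟩ := exists_polynomial_coeff z
  refine ⟨N, fun k hk => ?_⟩
  refine (dpBasis K (1 + 1)).repr.injective (Finsupp.ext fun s => ?_)
  rw [map_zero, Finsupp.zero_apply, coe_tensorIso, eq_pairIdx s]
  -- With the second index fixed at `k`, the diagonal entry and the far off-diagonal ones are values
  -- of one polynomial.
  obtain ⟨f, hf⟩ := hN k (s 1) (s 0 - k)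
  rw [hf k hk (s 0) (by omega)]
  suffices f = 0 by rw [this, Polynomial.eval_zero]
  by_contra hne
  obtain ⟨M, hM⟩ := exists_forall_eval_ne_zero hne
  -- The matching first index is `N + M + 1 + 2 * k`: it has the same difference `s 0 - k`, is at
  -- least `N`, and is not `k`, so `h` applies.
  refine hM (N + M + 1 + k + s 0) (by omega) ?_
  rw [← hf (N + M + 1 + 2 * k) (by omega) _ (by push_cast; omega), ← coe_tensorIso,
    h _ _ (by omega), map_zero, Finsupp.zero_apply]

/-- The multi-index `(k, k)`. -/
def diagIdx (k : ℕ) : Fin 2 →₀ ℕ := pairIdx k k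

theorem diagIdx_injective : Function.Injective diagIdx := fun k l h => by
  have := DFunLike.congr_fun h 0
  rwa [diagIdx, diagIdx, pairIdx_zero, pairIdx_zero] at this

theorem eq_diagIdx {s : Fin 2 →₀ ℕ} (h : s 0 = s 1) : s = diagIdx (s 0) := by
  conv_lhs => rw [eq_pairIdx s, ← h]
  rfl

theorem diagIdx_eq (k : ℕ) : diagIdx k 0 = diagIdx k 1 := by
  rw [diagIdx, pairIdx_zero, pairIdx_one]

/-- `z` has finitely many nonzero coordinates in a basis of `𝕀_m`, each an operator in two
variables. -/
theorem eventually_evalLeft_diag_eq_zero (z : algebraI K 2 ⊗[K] algebraI K m)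
    (h : ∀ s : Fin 2 →₀ ℕ, s 0 ≠ s 1 → evalLeft m (dpBasis K 2 s) z = 0) :
    ∃ N, ∀ k ≥ N, evalLeft m (dpBasis K 2 (diagIdx k)) z = 0 := by
  classical
  let C := Module.Basis.ofVectorSpace K (algebraI K m)
  set g := TensorProduct.equivFinsuppOfBasisRight C z with hg
  have hgi : ∀ i, ∃ N, ∀ k ≥ N, (g i).1 (dpBasis K 2 (diagIdx k)) = 0 := fun i =>
    eventually_apply_diag_eq_zero (g i) fun j₁ j₂ hj => by
      change (g i).1 (dpBasis K 2 (pairIdx j₁ j₂)) = 0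
      rw [hg, ← equivFinsupp_evalLeft, h _ (by rwa [pairIdx_zero, pairIdx_one]), map_zero,
        Finsupp.zero_apply]
  choose N hN using hgi
  refine ⟨g.support.sup N, fun k hk => ?_⟩
  refine (TensorProduct.equivFinsuppOfBasisRight C).injective (Finsupp.ext fun i => ?_)
  rw [equivFinsupp_evalLeft, map_zero, Finsupp.zero_apply, ← hg]
  by_cases hi : i ∈ g.support
  · exact hN i k ((Finset.le_sup hi).trans hk)
  · rw [Finsupp.notMem_support_iff.1 hi]
    rfl

variable (K m) in
/-- The map `(f_k)_k ↦ ∑_k E_k(f_k)`, where `E_k(p ⊗ c)` is the rank one operator that sends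
`x₁^k x₂^k / (k!)²` to `p`, tensored with `c`. -/
def diagSum : (ℕ →₀ (MvPolynomial (Fin 2) K ⊗[K] algebraI K m)) →ₗ[K]
    algebraI K 2 ⊗[K] algebraI K m :=
  Finsupp.lsum K fun k => LinearMap.rTensor _ (rankOne (diagIdx k))

theorem diagSum_single_tmul (k : ℕ) (p : MvPolynomial (Fin 2) K) (c : algebraI K m) :
    diagSum K m (Finsupp.single k (p ⊗ₜ c)) = rankOne (diagIdx k) p ⊗ₜ c := by
  rw [diagSum, Finsupp.lsum_single, LinearMap.rTensor_tmul]

theorem evalLeft_rTensor_rankOne_self (s : Fin n →₀ ℕ)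
    (w : MvPolynomial (Fin n) K ⊗[K] algebraI K m) :
    evalLeft m (dpBasis K n s) (LinearMap.rTensor _ (rankOne s) w) = w := by
  induction w with
  | zero => rw [map_zero, map_zero]
  | add w w' hw hw' => rw [map_add, map_add, hw, hw']
  | tmul p c => rw [LinearMap.rTensor_tmul, evalLeft_tmul, rankOne_apply_self]

theorem evalLeft_rTensor_rankOne_of_ne {s t : Fin n →₀ ℕ} (h : t ≠ s)
    (w : MvPolynomial (Fin n) K ⊗[K] algebraI K m) :
    evalLeft m (dpBasis K n t) (LinearMap.rTensor _ (rankOne s) w) = 0 := by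
  induction w with
  | zero => rw [map_zero, map_zero]
  | add w w' hw hw' => rw [map_add, map_add, hw, hw', add_zero]
  | tmul p c =>
    rw [LinearMap.rTensor_tmul, evalLeft_tmul, rankOne_apply_of_ne h, TensorProduct.zero_tmul]

theorem evalLeft_diagSum_of_ne {s : Fin 2 →₀ ℕ} (h : s 0 ≠ s 1)
    (f : ℕ →₀ (MvPolynomial (Fin 2) K ⊗[K] algebraI K m)) :
    evalLeft m (dpBasis K 2 s) (diagSum K m f) = 0 := by
  induction f using Finsupp.induction_linear with
  | zero => rw [map_zero, map_zero]
  | add f g hf hg => rw [map_add, map_add, hf, hg, add_zero]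
  | single k w =>
    rw [diagSum, Finsupp.lsum_single, evalLeft_rTensor_rankOne_of_ne]
    rintro rfl
    exact h (diagIdx_eq k)

theorem evalLeft_diagSum (k : ℕ) (f : ℕ →₀ (MvPolynomial (Fin 2) K ⊗[K] algebraI K m)) :
    evalLeft m (dpBasis K 2 (diagIdx k)) (diagSum K m f) = f k := by
  induction f using Finsupp.induction_linear with
  | zero => rw [map_zero, map_zero, Finsupp.zero_apply]
  | add f g hf hg => rw [map_add, map_add, hf, hg, Finsupp.add_apply]
  | single l w =>
    rw [diagSum, Finsupp.lsum_single]
    by_cases hkl : k = l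
    · subst hkl
      rw [evalLeft_rTensor_rankOne_self, Finsupp.single_eq_same]
    · rw [evalLeft_rTensor_rankOne_of_ne (diagIdx_injective.ne hkl), Finsupp.single_eq_of_ne hkl]

/-- The coefficients are the values of `z` on the diagonal; eventual vanishing makes their family
finitely supported. -/
theorem exists_diagSum_eq {z : algebraI K 2 ⊗[K] algebraI K m}
    (h : ∀ s : Fin 2 →₀ ℕ, s 0 ≠ s 1 → evalLeft m (dpBasis K 2 s) z = 0) :
    ∃ f, diagSum K m f = z := by
  obtain ⟨N, hN⟩ := eventually_evalLeft_diag_eq_zero z h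
  refine ⟨Finsupp.onFinset (Finset.range N) (fun k => evalLeft m (dpBasis K 2 (diagIdx k)) z)
    fun k hk => ?_, eq_of_evalLeft fun s => ?_⟩
  · by_contra hlt
    exact hk (hN k (by simpa using hlt))
  · by_cases hs : s 0 = s 1
    · rw [eq_diagIdx hs, evalLeft_diagSum, Finsupp.onFinset_apply]
    · rw [evalLeft_diagSum_of_ne hs, h s hs]

variable (K m) in
/-- The left ideal `{a | a (H_1 - H_2) = 0}` of `𝕀_{2+m}`. -/
abbrev kerDiff : LeftIdeal (algebraI K (2 + m)) :=
  kerMulRight (H K (Fin.castAdd m (0 : Fin 2)) - H K (Fin.castAdd m (1 : Fin 2)))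

theorem tensorIso_diagSum_mem (f : ℕ →₀ (MvPolynomial (Fin 2) K ⊗[K] algebraI K m)) :
    tensorIso K 2 m (diagSum K m f) ∈ kerDiff K m :=
  (tensorIso_mem_kerMulRight_iff _).2 fun _ hs => evalLeft_diagSum_of_ne hs f

theorem exists_tensorIso_diagSum_eq {a : algebraI K (2 + m)} (ha : a ∈ kerDiff K m) :
    ∃ f, tensorIso K 2 m (diagSum K m f) = a := by
  rw [← (tensorIso K 2 m).apply_symm_apply a] at ha
  obtain ⟨f, hf⟩ := exists_diagSum_eq ((tensorIso_mem_kerMulRight_iff _).1 ha)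
  exact ⟨f, by rw [hf, AlgEquiv.apply_symm_apply]⟩

theorem tensorIso_diagSum_injective :
    Function.Injective fun f => tensorIso K 2 m (diagSum K m f) := fun f g h =>
  Finsupp.ext fun k => by
    rw [← evalLeft_diagSum, (tensorIso K 2 m).injective h, evalLeft_diagSum]

theorem tensorIso_diagSum_add (f g : ℕ →₀ (MvPolynomial (Fin 2) K ⊗[K] algebraI K m)) :
    tensorIso K 2 m (diagSum K m (f + g)) =
      tensorIso K 2 m (diagSum K m f) + tensorIso K 2 m (diagSum K m g) := by
  rw [map_add, map_add]

variable (K m) in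
/-- The isomorphism of the direct sum of the modules `P_2 ⊗ 𝕀_m` with `{a | a (H_1 - H_2) = 0}`. -/
def diagSumEquiv : (ℕ →₀ (MvPolynomial (Fin 2) K ⊗[K] algebraI K m)) ≃+ kerDiff K m :=
  LeftIdeal.addEquivOfBijOn (kerDiff K m) (fun f => tensorIso K 2 m (diagSum K m f))
    tensorIso_diagSum_add tensorIso_diagSum_mem tensorIso_diagSum_injective
    fun _ ha => exists_tensorIso_diagSum_eq ha

theorem coe_diagSumEquiv (f : ℕ →₀ (MvPolynomial (Fin 2) K ⊗[K] algebraI K m)) :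
    (diagSumEquiv K m f : algebraI K (2 + m)) = tensorIso K 2 m (diagSum K m f) :=
  LeftIdeal.coe_addEquivOfBijOn _ _ _ _ _ _ f

/-- Pure tensors in single positions span the direct sum and the `a ⊗ b` span the algebra, so with
additivity this expresses linearity over `𝕀_{2+m}`. -/
theorem diagSumEquiv_single_mul (k : ℕ) (a : algebraI K 2) (b : algebraI K m)
    (p : MvPolynomial (Fin 2) K) (c : algebraI K m) :
    (diagSumEquiv K m (Finsupp.single k (a.1 p ⊗ₜ (b * c))) : algebraI K (2 + m)) =
      tensorIso K 2 m (a ⊗ₜ b) * (diagSumEquiv K m (Finsupp.single k (p ⊗ₜ c))) := by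
  rw [coe_diagSumEquiv, coe_diagSumEquiv, ← map_mul, diagSum_single_tmul, diagSum_single_tmul,
    Algebra.TensorProduct.tmul_mul_tmul, mul_rankOne]

variable (K m) in
/-- The left ideal of operators that annihilate `x₁^k x₂^k` as operators in the first two
variables. -/
def annDiag (k : ℕ) : LeftIdeal (algebraI K (2 + m)) where
  carrier := {a | evalLeft m (dpBasis K 2 (diagIdx k)) ((tensorIso K 2 m).symm a) = 0}
  zero_mem' := by rw [Set.mem_ofPred_eq, map_zero, map_zero]
  add_mem' {a b} ha hb := by
    rw [Set.mem_ofPred_eq] at ha hb ⊢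
    rw [map_add, map_add, ha, hb, add_zero]
  smul_mem' c a ha := by
    rw [Set.mem_ofPred_eq] at ha ⊢
    rw [smul_eq_mul, map_mul]
    exact evalLeft_mul_eq_zero ha _

/-- Finitely many generators, hence the whole ideal, would vanish at a common diagonal index `M`;
but the ideal contains a nonzero operator supported there. -/
theorem not_fg_kerDiff : ¬ (kerDiff K m).FG := by
  classical
  rintro ⟨G, hG⟩
  have hgi : ∀ g : G, ∃ N, ∀ k ≥ N, g.1 ∈ annDiag K m k := fun g => by
    have hg : g.1 ∈ kerDiff K m := hG ▸ Submodule.subset_span g.2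
    rw [← (tensorIso K 2 m).apply_symm_apply g.1] at hg
    exact eventually_evalLeft_diag_eq_zero _ ((tensorIso_mem_kerMulRight_iff _).1 hg)
  choose N hN using hgi
  set M := Finset.univ.sup N with hM
  have hle : kerDiff K m ≤ annDiag K m M := by
    rw [← hG, Submodule.span_le]
    exact fun g hg => hN ⟨g, hg⟩ M (Finset.le_sup (Finset.mem_univ _))
  have h := hle (tensorIso_diagSum_mem (Finsupp.single M (dpBasis K 2 0 ⊗ₜ 1)))
  change evalLeft m (dpBasis K 2 (diagIdx M)) ((tensorIso K 2 m).symm (tensorIso K 2 m _)) = 0 at h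
  rw [AlgEquiv.symm_apply_apply, evalLeft_diagSum, Finsupp.single_eq_same] at h
  have h' := congrArg (fun w => TensorProduct.equivFinsuppOfBasisLeft (dpBasis K 2) w 0) h
  simp only [TensorProduct.equivFinsuppOfBasisLeft_apply_tmul_apply, map_zero,
    Finsupp.zero_apply, Module.Basis.repr_self, Finsupp.single_eq_same, one_smul] at h'
  have h'' := LinearMap.congr_fun (congrArg Subtype.val h') (1 : MvPolynomial (Fin m) K)
  exact one_ne_zero h''

end IntegroDiff

end

theorem mainTheorem3 (K : Type*) [Field K] [CharZero K] :
    (∀ n : ℕ, 1 ≤ n →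
      (IsLeftCoherentRing (IntegroDiff.algebraI K n) ↔
        IsRightCoherentRing (IntegroDiff.algebraI K n)) ∧
      (IsRightCoherentRing (IntegroDiff.algebraI K n) ↔ n = 1)) ∧
    (∀ m : ℕ,
      (∃ e : (IntegroDiff.algebraI K 2 ⊗[K] IntegroDiff.algebraI K m) ≃ₐ[K]
          IntegroDiff.algebraI K (2 + m),
        IntegroDiff.IsCanonicalIso K e ∧
        ∃ φ : (ℕ →₀ (MvPolynomial (Fin 2) K ⊗[K] IntegroDiff.algebraI K m)) ≃+
            IntegroDiff.kerMulRight
              (IntegroDiff.H K (Fin.castAdd m (0 : Fin 2)) -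
                IntegroDiff.H K (Fin.castAdd m (1 : Fin 2))),
          ∀ (k : ℕ) (a : IntegroDiff.algebraI K 2) (b : IntegroDiff.algebraI K m)
            (p : MvPolynomial (Fin 2) K) (c : IntegroDiff.algebraI K m),
            (φ (Finsupp.single k
                ((a : Module.End K (MvPolynomial (Fin 2) K)) p ⊗ₜ[K] (b * c))) :
                  IntegroDiff.algebraI K (2 + m)) =
              e (a ⊗ₜ[K] b) *
                (φ (Finsupp.single k (p ⊗ₜ[K] c)) : IntegroDiff.algebraI K (2 + m))) ∧
      ¬ (IntegroDiff.kerMulRight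
          (IntegroDiff.H K (Fin.castAdd m (0 : Fin 2)) -
            IntegroDiff.H K (Fin.castAdd m (1 : Fin 2)))).FG) := by
  refine ⟨fun n hn => ?_, fun m => ⟨⟨IntegroDiff.tensorIso K 2 m,
    IntegroDiff.isCanonicalIso_tensorIso, IntegroDiff.diagSumEquiv K m,
    IntegroDiff.diagSumEquiv_single_mul⟩, IntegroDiff.not_fg_kerDiff⟩⟩
  have hlr := isLeftCoherentRing_iff_isRightCoherentRing
    (R := IntegroDiff.algebraI K n) (IntegroDiff.adjEquiv K n)
  refine ⟨hlr, fun h => ?_, ?_⟩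
  · by_contra hne
    obtain ⟨m, rfl⟩ := Nat.exists_eq_add_of_le (show 2 ≤ n by omega)
    -- In a left coherent ring the left annihilator of a single element is finitely generated.
    exact IntegroDiff.not_fg_kerDiff ((hlr.2 h).fg_kerMulRight _)
  · rintro rfl
    exact hlr.1 IntegroDiff.isLeftCoherentRing_algebraI_one
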